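/- **Theorem (SVD of the single-quadrant levels of the ADRT).** Let $2\le m\le n$ be integers and $N=2^n$. Write $[k]=\{0,\dots,k-1\}$ and let $$E^n_m=\{(h,s)\in\mathbb Z\times[2^n] : -(s \bmod 2^m)\le h<2^n\}.$$ For $f\in\mathbb R^{E^n_{m-1}}$ put $f_{\ell}(h,s)=f(h,s+\ell 2^{m-1})$, extended by $0$ where $(h,s+\ell 2^{m-1})\notin E^n_{m-1}$. The single-quadrant level $S^n_m:\mathbb R^{E^n_{m-1}}\to\mathbb R^{E^n_m}$, $g=S^n_m f$, is given for $\ell\in[2^{n-m}]$, $s\in[2^{m-1}]$, $\varepsilon\in\{0,1\}$ by $$g(h,\ell 2^m+2s+\varepsilon)=f_{2\ell}(h,s)+f_{2\ell+1}(h+s+\varepsilon,s),$$ and the level of the full ADRT is $S^n_{(m)}=\mathrm{Id}_4\otimes S^n_m$. *Blocks.* For $t\ge 1$ let $\Sigma_t=\operatorname{diag}\bigl(2\cos\tfrac{k\pi}{2t+2}\bigr)_{k=1}^t$, and let $U_t\in\mathbb R^{(t+1)\times t}$, $V_t\in\mathbb R^{t\times t}$ have the columns ($k=1,\dots,t$,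 rows $j$ counted from $0$) $$(u_k)_j=\sqrt{\tfrac{2}{t+1}}\,\sin\frac{k\pi(j+\frac12)}{t+1},\qquad (v_k)_j=\sqrt{\tfrac{2}{t+1}}\,\sin\frac{k\pi(j+1)}{t+1}.$$ Let $H_s\in\mathbb R^{2s\times s}$ have column $j\in[s]$ equal to $1$ in rows $2j,2j+1$ and $0$ elsewhere. For $s\in[2^{m-1}]$ put $$\mathcal U_s=\operatorname{diag}\bigl[\tfrac1{\sqrt2}H_s,\,U_{2N},\,\tfrac1{\sqrt2}H_s\bigr],\quad \mathcal S_s=\operatorname{diag}\bigl[\sqrt2\,\mathrm{Id}_s,\,\Sigma_{2N},\,\sqrt2\,\mathrm{Id}_s\bigr],\quad \mathcal V_s=\operatorname{diag}\bigl[\mathrm{Id}_s,\,V_{2N},\,\mathrm{Id}_s\bigr],$$ and let $U^n_m$, $\Sigma^n_m$, $V^n_m$ be $\mathrm{Id}_{2^{n-m}}\otimes\operatorname{blockdiag}_{s\in[2^{m-1}]}$ of $\mathcal U_s$, $\mathcal S_s$, $\mathcal V_s$, respectively. The rows of $U^n_m$ are thus indexed by $(\ell,s,j)$ with $\ell\in[2^{n-m}]$,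 $s\in[2^{m-1}]$, $j\in[2N+4s+1]$, and its columns, as well as the rows and columns of $\Sigma^n_m$ and $V^n_m$, by $(\ell,s,j)$ with $j\in[2N+2s]$. *Permutations.* For vectors $u,v$ of length $r$ and $0\le t<r$ let $$[u\mid v]_t=(u_0,\dots,u_{t-1},\,u_t,v_0,u_{t+1},v_1,\dots,u_{r-1},v_{r-t-1},\,v_{r-t},\dots,v_{r-1}).$$ Columns of data are read in the order of decreasing $h$, beginning with $h=N-1$. The matrix $P^n_m$ sends $f\in\mathbb R^{E^n_{m-1}}$ to the vector whose block $(\ell,s)$ is $[f_{2\ell}(\cdot,s)\mid f_{2\ell+1}(\cdot,s)]_s$, where the two columns have length $r=N+s$. The matrix $Q^n_m$ sends a vector to the $g\in\mathbb R^{E^n_m}$ for which block $(\ell,s)$ of the vector consists of the entries of the columns $g(\cdot,\ell2^m+2s+1)$ and $g(\cdot,\ell2^m+2s)$ (of lengths $N+2s+1$ and $N+2s$) taken alternately, beginning and ending with the former. *Conclusion.* With $$U^n_{(m)}=\mathrm{Id}_4\otimes(Q^n_mU^n_m),\qquad \Sigma^n_{(m)}=\mathrm{Id}_4\otimes\Sigma^n_m,\qquad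 V^n_{(m)}=\mathrm{Id}_4\otimes(P^{n\top}_mV^n_m),$$ one has $$S^n_{(m)}=U^n_{(m)}\Sigma^n_{(m)}V^{n\top}_{(m)},$$ and this is a (reduced) singular value decomposition up to the ordering of the singular values: $U^n_{(m)}$ and $V^n_{(m)}$ have orthonormal columns, and $\Sigma^n_{(m)}$ is diagonal with positive diagonal entries. Moreover there is an absolute constant $C$ such that, for all $2\le m\le n$, multiplication of a vector by each of $U^n_{(m)}$, $U^{n\top}_{(m)}$, $\Sigma^n_{(m)}$, $V^n_{(m)}$, $V^{n\top}_{(m)}$ can be carried out by a straight-line program of at most $C N^2\log N$ arithmetic operations (additions, subtractions and multiplications by fixed real constants). -/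

import Mathlib

open scoped Kronecker

namespace ADRT

/-! ### Index sets and the levels of the ADRT -/

/-- The index set of the ADRT data at level `m`: all `(h, s)` with `s ∈ {0, …, 2 ^ n - 1}` and
`-(s mod 2 ^ m) ≤ h < 2 ^ n` (see `mem_E`). -/
noncomputable def E (n m : ℕ) : Finset (ℤ × ℕ) :=
  (Finset.Ico (-(2 ^ m : ℤ)) (2 ^ n) ×ˢ Finset.range (2 ^ n)).filter
    fun p => -((p.2 % 2 ^ m : ℕ) : ℤ) ≤ p.1

theorem mem_E {n m : ℕ} {p : ℤ × ℕ} :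
    p ∈ E n m ↔ p.2 < 2 ^ n ∧ -((p.2 % 2 ^ m : ℕ) : ℤ) ≤ p.1 ∧ p.1 < 2 ^ n := by
  have h : ((p.2 % 2 ^ m : ℕ) : ℤ) < 2 ^ m := by
    have := Nat.mod_lt p.2 (show 0 < 2 ^ m by positivity)
    exact_mod_cast this
  simp only [E, Finset.mem_filter, Finset.mem_product, Finset.mem_Ico, Finset.mem_range]
  constructor
  · rintro ⟨⟨⟨_, h2⟩, h3⟩, h4⟩
    exact ⟨h3, h4, h2⟩
  · rintro ⟨h3, h4, h2⟩
    exact ⟨⟨⟨by linarith, h2⟩, h3⟩, h4⟩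

/-- The entry `f (h, s + ℓ * 2 ^ m)` of the `ℓ`-th section of level-`m` data `f`, where `f` is
extended by zero outside its index set. -/
noncomputable def sectionEntry {n m : ℕ} (f : E n m → ℝ) (ℓ : ℕ) (h : ℤ) (s : ℕ) : ℝ :=
  if hp : (h, s + ℓ * 2 ^ m) ∈ E n m then f ⟨(h, s + ℓ * 2 ^ m), hp⟩ else 0

/-- The single-quadrant ADRT level `S^n_m`. An output column is numbered
`ℓ * 2 ^ m + 2 * s + ε` with `s < 2 ^ (m - 1)` and `ε ∈ {0, 1}`; there
`g (h) = f_{2ℓ} (h, s) + f_{2ℓ+1} (h + s + ε, s)`, where `f_{2ℓ}` and `f_{2ℓ+1}` are sections of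
the level-`(m - 1)` data `f`. -/
noncomputable def singleLevel (n m : ℕ) : (E n (m - 1) → ℝ) →ₗ[ℝ] (E n m → ℝ) where
  toFun f p :=
    let h : ℤ := p.1.1
    let ℓ : ℕ := p.1.2 / 2 ^ m
    let s : ℕ := p.1.2 % 2 ^ m / 2
    let ε : ℕ := p.1.2 % 2 ^ m % 2
    sectionEntry f (2 * ℓ) h s + sectionEntry f (2 * ℓ + 1) (h + s + ε) s
  map_add' f g := by
    funext p
    simp only [sectionEntry, Pi.add_apply]
    split_ifs <;> ring
  map_smul' c f := by
    funext p
    simp only [sectionEntry, Pi.smul_apply, smul_eq_mul, RingHom.id_apply]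
    split_ifs <;> ring

/-- The level `S^n_(m)` (`m ≥ 2`) of the full, four-quadrant ADRT: `Id_4 ⊗ S^n_m`. -/
noncomputable def fullLevel (n m : ℕ) : Matrix (Fin 4 × E n m) (Fin 4 × E n (m - 1)) ℝ :=
  (1 : Matrix (Fin 4) (Fin 4) ℝ) ⊗ₖ LinearMap.toMatrix' (singleLevel n m)

/-! ### Blocks of the decomposition -/

/-- The `(t + 1) × t` matrix of left singular vectors of the convolution matrix with kernel
`[1, 1]`: normalized sine columns `k = 1, …, t`. -/
noncomputable def dstU (t : ℕ) : Matrix (Fin (t + 1)) (Fin t) ℝ :=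
  Matrix.of fun j k =>
    √(2 / ((t : ℝ) + 1)) *
      Real.sin (((k : ℝ) + 1) * Real.pi * ((j : ℝ) + 1 / 2) / ((t : ℝ) + 1))

/-- The `t × t` matrix of right singular vectors: normalized sine columns `k = 1, …, t`. -/
noncomputable def dstV (t : ℕ) : Matrix (Fin t) (Fin t) ℝ :=
  Matrix.of fun j k =>
    √(2 / ((t : ℝ) + 1)) *
      Real.sin (((k : ℝ) + 1) * Real.pi * ((j : ℝ) + 1) / ((t : ℝ) + 1))

/-- The diagonal matrix of the singular values `2 cos (k π / (2 t + 2))`, `k = 1, …, t`. -/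
noncomputable def dstSigma (t : ℕ) : Matrix (Fin t) (Fin t) ℝ :=
  Matrix.diagonal fun k => 2 * Real.cos (((k : ℝ) + 1) * Real.pi / (2 * (t : ℝ) + 2))

/-- The `2 t × t` matrix `H_t`, whose column `j` has ones in the rows `2 j` and `2 j + 1`. -/
def H (t : ℕ) : Matrix (Fin (2 * t)) (Fin t) ℝ :=
  Matrix.of fun i j => if (i : ℕ) / 2 = (j : ℕ) then 1 else 0

/-- The block diagonal matrix `diag [A, B, C]` with rectangular blocks. -/
def diag3 {a₁ a₂ b₁ b₂ c₁ c₂ : Type*} (A : Matrix a₁ a₂ ℝ) (B : Matrix b₁ b₂ ℝ)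
    (C : Matrix c₁ c₂ ℝ) : Matrix (a₁ ⊕ b₁ ⊕ c₁) (a₂ ⊕ b₂ ⊕ c₂) ℝ :=
  Matrix.fromBlocks A 0 0 (Matrix.fromBlocks B 0 0 C)

/-- The `2 N + 4 s + 1` row positions of the `s`-th block, split as `2 s`, `2 N + 1`, `2 s`. -/
abbrev RowBlock (N s : ℕ) : Type := Fin (2 * s) ⊕ Fin (2 * N + 1) ⊕ Fin (2 * s)

/-- The `2 N + 2 s` column positions of the `s`-th block, split as `s`, `2 N`, `s`. -/
abbrev ColBlock (N s : ℕ) : Type := Fin s ⊕ Fin (2 * N) ⊕ Fin s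

/-- The position (counted from `0`) within a vector that is split into three consecutive pieces. -/
def pos {a b c : ℕ} : Fin a ⊕ Fin b ⊕ Fin c → ℕ
  | Sum.inl i => i
  | Sum.inr (Sum.inl i) => a + i
  | Sum.inr (Sum.inr i) => a + b + i

/-- `U_s = diag [H_s / √2, U_{2N}, H_s / √2]`. -/
noncomputable def blockU (N s : ℕ) : Matrix (RowBlock N s) (ColBlock N s) ℝ :=
  diag3 ((√2)⁻¹ • H s) (dstU (2 * N)) ((√2)⁻¹ • H s)

/-- `Σ_s = diag [√2 Id_s, Σ_{2N}, √2 Id_s]`. -/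
noncomputable def blockSigma (N s : ℕ) : Matrix (ColBlock N s) (ColBlock N s) ℝ :=
  diag3 (√2 • (1 : Matrix (Fin s) (Fin s) ℝ)) (dstSigma (2 * N))
    (√2 • (1 : Matrix (Fin s) (Fin s) ℝ))

/-- `V_s = diag [Id_s, V_{2N}, Id_s]`. -/
noncomputable def blockV (N s : ℕ) : Matrix (ColBlock N s) (ColBlock N s) ℝ :=
  diag3 1 (dstV (2 * N)) 1

/-- Index set of the flattened output: section `ℓ`, block `s`, position in the block. -/
abbrev RowIdx (n m : ℕ) : Type :=
  Fin (2 ^ (n - m)) × ((s : Fin (2 ^ (m - 1))) × RowBlock (2 ^ n) s)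

/-- Index set of the flattened input: section pair `ℓ`, block `s`, position in the block. -/
abbrev ColIdx (n m : ℕ) : Type :=
  Fin (2 ^ (n - m)) × ((s : Fin (2 ^ (m - 1))) × ColBlock (2 ^ n) s)

/-- `U^n_m = Id ⊗ blockdiag [U_0, U_1, …]`, with `2 ^ (n - m)` copies of the `2 ^ (m - 1)`
blocks. -/
noncomputable def levelU (n m : ℕ) : Matrix (RowIdx n m) (ColIdx n m) ℝ :=
  (1 : Matrix (Fin (2 ^ (n - m))) (Fin (2 ^ (n - m))) ℝ) ⊗ₖ
    Matrix.blockDiagonal' fun s : Fin (2 ^ (m - 1)) => blockU (2 ^ n) s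

/-- `Σ^n_m = Id ⊗ blockdiag [Σ_0, Σ_1, …]`. -/
noncomputable def levelSigma (n m : ℕ) : Matrix (ColIdx n m) (ColIdx n m) ℝ :=
  (1 : Matrix (Fin (2 ^ (n - m))) (Fin (2 ^ (n - m))) ℝ) ⊗ₖ
    Matrix.blockDiagonal' fun s : Fin (2 ^ (m - 1)) => blockSigma (2 ^ n) s

/-- `V^n_m = Id ⊗ blockdiag [V_0, V_1, …]`. -/
noncomputable def levelV (n m : ℕ) : Matrix (ColIdx n m) (ColIdx n m) ℝ :=
  (1 : Matrix (Fin (2 ^ (n - m))) (Fin (2 ^ (n - m))) ℝ) ⊗ₖ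
    Matrix.blockDiagonal' fun s : Fin (2 ^ (m - 1)) => blockV (2 ^ n) s

/-! ### The flattening and unflattening permutations -/

/-- The alternating concatenation with shift `[u | v]_t` of two vectors of length `r` is
`u_0, …, u_{t-1}, u_t, v_0, u_{t+1}, v_1, …, u_{r-1}, v_{r-t-1}, v_{r-t}, …, v_{r-1}`.
`altIndex r t j` is `(0, i)` if the entry at position `j` is `u_i` and `(1, i)` if it is `v_i`. -/
def altIndex (r t j : ℕ) : ℕ × ℕ :=
  if j < t then (0, j)
  else if j < 2 * r - t then
    if (j - t) % 2 = 0 then (0, t + (j - t) / 2) else (1, (j - t) / 2)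
  else (1, j - r)

/-- The column of level-`m` data, listed from the top: its `i`-th entry has `h = 2 ^ n - 1 - i`. -/
def columnEntry (n i : ℕ) : ℤ := 2 ^ n - 1 - (i : ℤ)

/-- The place in level-`(m - 1)` data `f` whose value the flattening writes at an index
`(ℓ, s, j)`: the `j`-th block entry of `[f_{2ℓ, s} | f_{2ℓ+1, s}]_s`, where the columns
`f_{2ℓ, s}` and `f_{2ℓ+1, s}` have length `r = 2 ^ n + s` and are listed from the top. -/
def flattenSource (n m : ℕ) (x : ColIdx n m) : ℤ × ℕ :=
  let ℓ : ℕ := x.1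
  let s : ℕ := x.2.1
  let c := altIndex (2 ^ n + s) s (pos x.2.2)
  (columnEntry n c.2, s + (2 * ℓ + c.1) * 2 ^ (m - 1))

/-- The place in level-`m` data `g` to which the unflattening writes the entry with index
`(ℓ, s, j)`: block `s` of section `ℓ` is `[g_{ℓ, 2s+1} | g_{ℓ, 2s}]_0` with the last entry
dropped, where the columns, of lengths `2 ^ n + 2 s + 1` and `2 ^ n + 2 s`, are listed from
the top. -/
def unflattenTarget (n m : ℕ) (y : RowIdx n m) : ℤ × ℕ :=
  let ℓ : ℕ := y.1
  let s : ℕ := y.2.1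
  let c := altIndex (2 ^ n + 2 * s + 1) 0 (pos y.2.2)
  (columnEntry n c.2, ℓ * 2 ^ m + (2 * s + 1 - c.1))

/-- The matrix `P^n_m` of the flattening permutation, `(P f) x = f (flattenSource x)`. -/
noncomputable def permP (n m : ℕ) : Matrix (ColIdx n m) (E n (m - 1)) ℝ :=
  Matrix.of fun x e => if (e : ℤ × ℕ) = flattenSource n m x then 1 else 0

/-- The matrix `Q^n_m` of the unflattening permutation, `(Q v) (unflattenTarget y) = v y`. -/
noncomputable def permQ (n m : ℕ) : Matrix (E n m) (RowIdx n m) ℝ :=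
  Matrix.of fun e y => if (e : ℤ × ℕ) = unflattenTarget n m y then 1 else 0

/-! ### The factors -/

/-- `U^n_(m) = Id_4 ⊗ (Q^n_m U^n_m)`. -/
noncomputable def fullU (n m : ℕ) : Matrix (Fin 4 × E n m) (Fin 4 × ColIdx n m) ℝ :=
  (1 : Matrix (Fin 4) (Fin 4) ℝ) ⊗ₖ (permQ n m * levelU n m)

/-- `Σ^n_(m) = Id_4 ⊗ Σ^n_m`. -/
noncomputable def fullSigma (n m : ℕ) : Matrix (Fin 4 × ColIdx n m) (Fin 4 × ColIdx n m) ℝ :=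
  (1 : Matrix (Fin 4) (Fin 4) ℝ) ⊗ₖ levelSigma n m

/-- `V^n_(m) = Id_4 ⊗ ((P^n_m)ᵀ V^n_m)`. -/
noncomputable def fullV (n m : ℕ) : Matrix (Fin 4 × E n (m - 1)) (Fin 4 × ColIdx n m) ℝ :=
  (1 : Matrix (Fin 4) (Fin 4) ℝ) ⊗ₖ ((permP n m).transpose * levelV n m)

/-- `A = U S Vᵀ` is a (reduced) singular value decomposition, up to the ordering of the singular
values: `U` and `V` have orthonormal columns and `S` is diagonal with positive entries. -/
structure IsSVD {ι κ ρ : Type*} [Fintype ι] [Fintype κ] [Fintype ρ] [DecidableEq ρ]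
    (A : Matrix ι κ ℝ) (U : Matrix ι ρ ℝ) (S : Matrix ρ ρ ℝ) (V : Matrix κ ρ ℝ) : Prop where
  eq_mul : A = U * S * V.transpose
  left_orthonormal : U.transpose * U = 1
  right_orthonormal : V.transpose * V = 1
  isDiag : S.IsDiag
  diag_pos : ∀ k, 0 < S k k

/-! ### Operation counts -/

/-- Straight-line programs on a real input vector `x : ι → ℝ`. `Computes k F` says that some
program with exactly `k` arithmetic operations has computed precisely the quantities in `F`
(functions of the input, the input entries included); each operation adds or subtracts two
quantities that are already available, or multiplies one by a fixed real constant. -/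
inductive Computes {ι : Type*} : ℕ → Set ((ι → ℝ) → ℝ) → Prop
  | input : Computes 0 (Set.range fun (i : ι) (x : ι → ℝ) => x i)
  | add {k : ℕ} {F : Set ((ι → ℝ) → ℝ)} {f g : (ι → ℝ) → ℝ} :
      Computes k F → f ∈ F → g ∈ F → Computes (k + 1) (insert (fun x => f x + g x) F)
  | sub {k : ℕ} {F : Set ((ι → ℝ) → ℝ)} {f g : (ι → ℝ) → ℝ} :
      Computes k F → f ∈ F → g ∈ F → Computes (k + 1) (insert (fun x => f x - g x) F)
  | smul {k : ℕ} {F : Set ((ι → ℝ) → ℝ)} {f : (ι → ℝ) → ℝ} (c : ℝ) :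
      Computes k F → f ∈ F → Computes (k + 1) (insert (fun x => c * f x) F)

/-- All entries of the product `A x` can be computed from the entries of `x` by a straight-line
program with at most `B` arithmetic operations. -/
def MulVecCostLE {ι κ : Type*} [Fintype κ] (A : Matrix ι κ ℝ) (B : ℝ) : Prop :=
  ∃ (k : ℕ) (F : Set ((κ → ℝ) → ℝ)), Computes k F ∧ (k : ℝ) ≤ B ∧
    ∀ i, (fun x => A.mulVec x i) ∈ F

end ADRT

namespace ADRT

/-! ### Orthogonality of the sine bases -/

section Trigonometry

open Finset Real

/-! The interleavings are chosen so that, between flattened data, the level acts on block `(ℓ, s)`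
as `diag [H_s, C, H_s]`, where `C` is full convolution with the kernel `[1, 1]`. In the middle part
each output adds two neighbouring entries, one from each input column. In the top `2s` output
positions the shifted second column is read above its range, and in the bottom `2s` the first column
is read below its range, so there each entry of the other column is copied twice. This is
`singleLevel_apply_eq_levelConv_mulVec`.

The outer blocks factor as `H = (H / √2) (√2 Id)`, and `H / √2` has orthonormal columns. For `C`,
the identity `sin (x + δ) + sin (x - δ) = 2 cos δ sin x` gives `C V = U Σ`; the zero boundary values
agree because the sine columns of `V` vanish one step beyond each end (`convMatrix_mul_dstV`).
Orthonormality of the sine columns is a product-to-sum computation. Direct sums and permutations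
preserve all of this.

For the operation count, the permutations are free and the outer blocks take linearly many
operations. The sine matrices are multiplied by Bluestein's method (`MulCost.sine`): the product of
frequency and position is split into squares, leaving a Toeplitz matrix, which is embedded into a
circulant one and applied by two fast Fourier transforms (`ComputableFrom.toeplitz`,
`ComputableFrom.fourier`). A block thus takes `O(N log N)` operations, and there are `4 * 2 ^ (n -
m) * 2 ^ (m - 1) = 2 N` blocks whatever `m` is. -/

theorem two_mul_sin_half_mul_sum_cos_midpoint (φ : ℝ) (n : ℕ) :
    2 * sin (φ / 2) * ∑ j ∈ range n, cos (φ * ((j : ℝ) + 1 / 2)) = sin (φ * n) := by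
  induction n with
  | zero => simp
  | succ n ih =>
    rw [sum_range_succ, mul_add, ih]
    -- The sum telescopes: both sines lie half a step from the midpoint at which the cosine is
    -- taken.
    have h1 : sin (φ * n) = sin (φ * ((n : ℝ) + 1 / 2) - φ / 2) := by ring_nf
    have h2 : sin (φ * ((n + 1 : ℕ) : ℝ)) = sin (φ * ((n : ℝ) + 1 / 2) + φ / 2) := by
      push_cast; ring_nf
    rw [h1, h2, sin_sub, sin_add]
    ring

theorem two_mul_sin_half_mul_sum_cos (φ : ℝ) (n : ℕ) :
    2 * sin (φ / 2) * ∑ j ∈ range n, cos (φ * (j : ℝ)) =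
      sin (φ * ((n : ℝ) - 1 / 2)) + sin (φ / 2) := by
  induction n with
  | zero => simp [show φ * 2⁻¹ = φ / 2 by ring]
  | succ n ih =>
    rw [sum_range_succ, mul_add, ih]
    have h1 : sin (φ * ((n : ℝ) - 1 / 2)) = sin (φ * (n : ℝ) - φ / 2) := by ring_nf
    have h2 : sin (φ * (((n + 1 : ℕ) : ℝ) - 1 / 2)) = sin (φ * (n : ℝ) + φ / 2) := by
      push_cast; ring_nf
    rw [h1, h2, sin_sub, sin_add]
    ring

/-- The angle is nonzero and lies strictly between `-π` and `π`. This permits division by the factor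
in the telescoped sums. -/
theorem sin_int_mul_pi_div_ne_zero {T : ℕ} {d : ℤ} (hd : d ≠ 0) (hd' : |d| < 2 * T) :
    sin (d * π / T / 2) ≠ 0 := by
  have hT : (0 : ℝ) < T := by
    have : (0 : ℤ) < T := by have := abs_nonneg d; omega
    exact_mod_cast this
  rw [Ne, sin_eq_zero_iff]
  rintro ⟨k, hk⟩
  have h : (k : ℝ) * (2 * T) = d := by
    have := pi_ne_zero
    field_simp at hk
    linarith
  have h' : k * (2 * T) = d := by exact_mod_cast h
  have hk0 : k ≠ 0 := by rintro rfl; simp at h'; exact hd h'.symm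
  have : (1 : ℤ) ≤ |k| := Int.one_le_abs hk0
  rw [← h', abs_mul, abs_of_nonneg (by positivity : (0 : ℤ) ≤ 2 * T)] at hd'
  nlinarith

theorem sum_cos_midpoint_eq_zero {T : ℕ} {d : ℤ} (hd : d ≠ 0) (hd' : |d| < 2 * T) :
    ∑ j ∈ range T, cos (d * π / T * ((j : ℝ) + 1 / 2)) = 0 := by
  have hs := sin_int_mul_pi_div_ne_zero hd hd'
  have hT : (T : ℝ) ≠ 0 := by
    rintro h
    simp [h] at hs
  have h := two_mul_sin_half_mul_sum_cos_midpoint (d * π / T) T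
  rw [div_mul_cancel₀ _ hT, sin_int_mul_pi] at h
  simpa [hs] using h

/-- Unlike the midpoint sum this one need not vanish, but it depends only on the parity of `d`. As
`k - l` and `k + l` have equal parity, the two contributions cancel in `sum_sin_mul_sin`. -/
theorem sum_cos_eq {T : ℕ} {d : ℤ} (hd : d ≠ 0) (hd' : |d| < 2 * T) :
    ∑ j ∈ range T, cos (d * π / T * (j : ℝ)) = (1 - (-1) ^ d) / 2 := by
  have hs := sin_int_mul_pi_div_ne_zero hd hd'
  have hT : (T : ℝ) ≠ 0 := by
    rintro h
    simp [h] at hs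
  have h := two_mul_sin_half_mul_sum_cos (d * π / T) T
  have h1 : d * π / T * ((T : ℝ) - 1 / 2) = d * π - d * π / T / 2 := by field_simp
  rw [h1, sin_int_mul_pi_sub] at h
  apply mul_left_cancel₀ hs
  linarith

theorem sum_sin_mul_sin_midpoint {T k l : ℕ} (hk : 0 < k) (hkT : k < T) (hl : 0 < l)
    (hlT : l < T) :
    ∑ j ∈ range T, sin (k * π * ((j : ℝ) + 1 / 2) / T) * sin (l * π * ((j : ℝ) + 1 / 2) / T) =
      if k = l then (T : ℝ) / 2 else 0 := by
  have hsum : ∀ j ∈ range T,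
      sin (k * π * ((j : ℝ) + 1 / 2) / T) * sin (l * π * ((j : ℝ) + 1 / 2) / T) =
      (cos (((k - l : ℤ) : ℝ) * π / T * ((j : ℝ) + 1 / 2)) -
        cos (((k + l : ℤ) : ℝ) * π / T * ((j : ℝ) + 1 / 2))) / 2 := by
    intro j _
    have h1 : ((k - l : ℤ) : ℝ) * π / T * ((j : ℝ) + 1 / 2) =
      k * π * ((j : ℝ) + 1 / 2) / T - l * π * ((j : ℝ) + 1 / 2) / T := by push_cast; ring
    have h2 : ((k + l : ℤ) : ℝ) * π / T * ((j : ℝ) + 1 / 2) =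
      k * π * ((j : ℝ) + 1 / 2) / T + l * π * ((j : ℝ) + 1 / 2) / T := by push_cast; ring
    rw [h1, h2, cos_sub, cos_add]
    ring
  rw [sum_congr rfl hsum, ← sum_div, sum_sub_distrib,
    sum_cos_midpoint_eq_zero (T := T) (d := k + l) (by omega) (by rw [abs_lt]; omega)]
  split_ifs with h
  · subst h; simp
  · rw [sum_cos_midpoint_eq_zero (T := T) (by omega) (by rw [abs_lt]; omega)]
    simp

theorem sum_sin_mul_sin {T k l : ℕ} (hk : 0 < k) (hkT : k < T) (hl : 0 < l) (hlT : l < T) :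
    ∑ j ∈ range T, sin (k * π * (j : ℝ) / T) * sin (l * π * (j : ℝ) / T) =
      if k = l then (T : ℝ) / 2 else 0 := by
  have hsum : ∀ j ∈ range T,
      sin (k * π * (j : ℝ) / T) * sin (l * π * (j : ℝ) / T) =
      (cos (((k - l : ℤ) : ℝ) * π / T * (j : ℝ)) -
        cos (((k + l : ℤ) : ℝ) * π / T * (j : ℝ))) / 2 := by
    intro j _
    have h1 : ((k - l : ℤ) : ℝ) * π / T * (j : ℝ) =
      k * π * (j : ℝ) / T - l * π * (j : ℝ) / T := by push_cast; ring
    have h2 : ((k + l : ℤ) : ℝ) * π / T * (j : ℝ) =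
      k * π * (j : ℝ) / T + l * π * (j : ℝ) / T := by push_cast; ring
    rw [h1, h2, cos_sub, cos_add]
    ring
  rw [sum_congr rfl hsum, ← sum_div, sum_sub_distrib,
    sum_cos_eq (T := T) (d := k + l) (by omega) (by rw [abs_lt]; omega)]
  split_ifs with h
  · subst h
    have : Even ((k : ℤ) + k) := ⟨k, rfl⟩
    simp [this.neg_one_zpow]
  · rw [sum_cos_eq (T := T) (by omega) (by rw [abs_lt]; omega)]
    have h2 : (-1 : ℝ) ^ ((k : ℤ) + l) = (-1) ^ ((k : ℤ) - l) := by
      rw [show (k : ℤ) + l = k - l + 2 * l by ring, zpow_add₀ (by norm_num),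
        (even_two_mul (l : ℤ)).neg_one_zpow, mul_one]
    rw [h2]; simp

end Trigonometry

theorem dstU_transpose_mul_self (t : ℕ) : (dstU t).transpose * dstU t = 1 := by
  ext k l
  have hs : √(2 / ((t : ℝ) + 1)) * √(2 / ((t : ℝ) + 1)) = 2 / ((t : ℝ) + 1) :=
    Real.mul_self_sqrt (by positivity)
  have h := sum_sin_mul_sin_midpoint (T := t + 1) (k := k + 1) (l := l + 1)
    (by omega) (by omega) (by omega) (by omega)
  push_cast at h
  rw [Finset.sum_range] at h
  simp only [Matrix.mul_apply, Matrix.transpose_apply, dstU, Matrix.of_apply]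
  calc _ = 2 / ((t : ℝ) + 1) * ∑ i : Fin (t + 1),
        Real.sin (((k : ℝ) + 1) * Real.pi * ((i : ℝ) + 1 / 2) / ((t : ℝ) + 1)) *
        Real.sin (((l : ℝ) + 1) * Real.pi * ((i : ℝ) + 1 / 2) / ((t : ℝ) + 1)) := by
        rw [Finset.mul_sum]
        refine Finset.sum_congr rfl fun i _ => ?_
        rw [mul_mul_mul_comm, hs]
    _ = _ := by
        rw [h, Matrix.one_apply]
        have : (t : ℝ) + 1 ≠ 0 := by positivity
        by_cases hkl : k = l
        · subst hkl; simp [field, this]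
        · have : (k : ℕ) ≠ l := fun h => hkl (Fin.ext h)
          simp [hkl, this]

theorem dstV_transpose_mul_self (t : ℕ) : (dstV t).transpose * dstV t = 1 := by
  ext k l
  have hs : √(2 / ((t : ℝ) + 1)) * √(2 / ((t : ℝ) + 1)) = 2 / ((t : ℝ) + 1) :=
    Real.mul_self_sqrt (by positivity)
  have h := sum_sin_mul_sin (T := t + 1) (k := k + 1) (l := l + 1)
    (by omega) (by omega) (by omega) (by omega)
  -- The term at position `0` vanishes; removing it leaves the `t` rows of `dstV`, at positions `1,
  -- …, t`.
  rw [Finset.sum_range_succ'] at h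
  push_cast at h
  rw [Finset.sum_range] at h
  simp only [mul_zero, zero_div, Real.sin_zero, add_zero] at h
  simp only [Matrix.mul_apply, Matrix.transpose_apply, dstV, Matrix.of_apply]
  calc _ = 2 / ((t : ℝ) + 1) * ∑ i : Fin t,
        Real.sin (((k : ℝ) + 1) * Real.pi * ((i : ℝ) + 1) / ((t : ℝ) + 1)) *
        Real.sin (((l : ℝ) + 1) * Real.pi * ((i : ℝ) + 1) / ((t : ℝ) + 1)) := by
        rw [Finset.mul_sum]
        refine Finset.sum_congr rfl fun i _ => ?_
        rw [mul_mul_mul_comm, hs]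
    _ = _ := by
        rw [h, Matrix.one_apply]
        have : (t : ℝ) + 1 ≠ 0 := by positivity
        by_cases hkl : k = l
        · subst hkl; simp [field, this]
        · have : (k : ℕ) ≠ l := fun h => hkl (Fin.ext h)
          simp [hkl, this]

theorem dstV_mul_transpose_self (t : ℕ) : dstV t * (dstV t).transpose = 1 :=
  mul_eq_one_comm.mp (dstV_transpose_mul_self t)

theorem dstSigma_pos (t : ℕ) (k : Fin t) : 0 < dstSigma t k k := by
  simp only [dstSigma, Matrix.diagonal_apply_eq]
  have ht : (0 : ℝ) < 2 * (t : ℝ) + 2 := by positivity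
  have hk : (k : ℝ) + 1 ≤ t := by exact_mod_cast k.2
  refine mul_pos two_pos (Real.cos_pos_of_mem_Ioo ⟨?_, ?_⟩)
  · have : 0 ≤ ((k : ℝ) + 1) * Real.pi / (2 * (t : ℝ) + 2) := by positivity
    linarith [Real.pi_pos]
  · rw [div_lt_iff₀ ht]
    nlinarith [Real.pi_pos]

/-- The `(t + 1) × t` matrix of the convolution with the kernel `[1, 1]`. -/
def convMatrix (t : ℕ) : Matrix (Fin (t + 1)) (Fin t) ℝ :=
  Matrix.of fun j k => (if (j : ℕ) = k then 1 else 0) + (if (j : ℕ) = k + 1 then 1 else 0)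

theorem sum_ite_val_eq {M : Type*} [AddCommMonoid M] {t : ℕ} (j : ℕ) (w : Fin t → M) :
    (∑ k : Fin t, if j = (k : ℕ) then w k else 0) = if h : j < t then w ⟨j, h⟩ else 0 := by
  split_ifs with h
  · rw [Finset.sum_eq_single ⟨j, h⟩]
    · simp
    · intro b _ hb
      rw [if_neg]
      rintro rfl
      exact hb rfl
    · simp
  · exact Finset.sum_eq_zero fun k _ => if_neg (by omega)

/-- Row `j` adds the sine at the sample points `j + 1` and `j`, which lie half a step on either side
of the sample point `j + 1 / 2` of `dstU`. The half step contributes the cosine. -/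
theorem convMatrix_mul_dstV (t : ℕ) : convMatrix t * dstV t = dstU t * dstSigma t := by
  ext j k
  have ht : (t : ℝ) + 1 ≠ 0 := by positivity
  rw [dstSigma, Matrix.mul_diagonal, Matrix.mul_apply]
  -- The sine formula also covers the missing row `i = t`, since `sin ((k + 1) π) = 0`.
  have hV : ∀ (i : ℕ), (∑ l : Fin t, if i = (l : ℕ) then dstV t l k else 0) =
      if i ≤ t then √(2 / ((t : ℝ) + 1)) *
        Real.sin (((k : ℝ) + 1) * Real.pi * ((i : ℝ) + 1) / ((t : ℝ) + 1)) else 0 := by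
    intro i
    rw [sum_ite_val_eq i fun l => dstV t l k]
    rcases lt_trichotomy i t with h | h | h
    · simp [h, h.le, dstV]
    · subst h
      rw [dif_neg (lt_irrefl _), if_pos le_rfl, mul_div_assoc, div_self ht, mul_one]
      have := Real.sin_nat_mul_pi ((k : ℕ) + 1)
      push_cast at this
      simp [this]
    · simp [h.not_gt, h.not_ge]
  have h1 : ∑ l : Fin t, convMatrix t j l * dstV t l k =
      (∑ l : Fin t, if (j : ℕ) = (l : ℕ) then dstV t l k else 0) +
      ∑ l : Fin t, if (j : ℕ) = (l : ℕ) + 1 then dstV t l k else 0 := by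
    rw [← Finset.sum_add_distrib]
    refine Finset.sum_congr rfl fun l _ => ?_
    simp only [convMatrix, Matrix.of_apply, add_mul, ite_mul, one_mul, zero_mul]
  have h2 : (∑ l : Fin t, if (j : ℕ) = (l : ℕ) + 1 then dstV t l k else 0) =
      √(2 / ((t : ℝ) + 1)) *
        Real.sin (((k : ℝ) + 1) * Real.pi * (j : ℝ) / ((t : ℝ) + 1)) := by
    obtain ⟨j, hj⟩ := j
    cases j with
    | zero => simp
    | succ i =>
      simp only [add_left_inj]
      rw [hV, if_pos (by omega)]
      push_cast
      rfl
  rw [h1, h2, hV, if_pos (by omega)]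
  simp only [dstU, Matrix.of_apply]
  have e1 : ((k : ℝ) + 1) * Real.pi * ((j : ℝ) + 1) / ((t : ℝ) + 1) =
      ((k : ℝ) + 1) * Real.pi * ((j : ℝ) + 1 / 2) / ((t : ℝ) + 1) +
        ((k : ℝ) + 1) * Real.pi / (2 * (t : ℝ) + 2) := by
    field_simp
    ring
  have e2 : ((k : ℝ) + 1) * Real.pi * (j : ℝ) / ((t : ℝ) + 1) =
      ((k : ℝ) + 1) * Real.pi * ((j : ℝ) + 1 / 2) / ((t : ℝ) + 1) -
        ((k : ℝ) + 1) * Real.pi / (2 * (t : ℝ) + 2) := by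
    field_simp
    ring
  rw [e1, e2, Real.sin_add, Real.sin_sub]
  ring

theorem dstU_mul_dstSigma_mul_dstV_transpose (t : ℕ) :
    dstU t * dstSigma t * (dstV t).transpose = convMatrix t := by
  rw [← convMatrix_mul_dstV, Matrix.mul_assoc, dstV_mul_transpose_self, Matrix.mul_one]

/-! ### The flattening and unflattening permutations as equivalences -/

theorem pos_lt {a b c : ℕ} (x : Fin a ⊕ Fin b ⊕ Fin c) : pos x < a + b + c := by
  rcases x with x | x | x <;> simp only [pos] <;> omega

theorem pos_injective {a b c : ℕ} :
    Function.Injective (pos : Fin a ⊕ Fin b ⊕ Fin c → ℕ) := by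
  rintro (x | x | x) (y | y | y) h <;> simp only [pos] at h <;>
    first
    | omega
    | (simp only [Sum.inl.injEq, Sum.inr.injEq, Fin.ext_iff]; omega)

theorem exists_pos_eq {a b c j : ℕ} (hj : j < a + b + c) :
    ∃ x : Fin a ⊕ Fin b ⊕ Fin c, pos x = j := by
  by_cases h1 : j < a
  · exact ⟨Sum.inl ⟨j, h1⟩, rfl⟩
  by_cases h2 : j < a + b
  · exact ⟨Sum.inr (Sum.inl ⟨j - a, by omega⟩), by simp only [pos]; omega⟩
  · exact ⟨Sum.inr (Sum.inr ⟨j - (a + b), by omega⟩), by simp only [pos]; omega⟩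

theorem altIndex_injective {r t : ℕ} (ht : t ≤ r) {i j : ℕ} (h : altIndex r t i = altIndex r t j) :
    i = j := by
  unfold altIndex at h
  split_ifs at h <;> simp only [Prod.mk.injEq] at h <;> omega

theorem altIndex_fst_le (r t j : ℕ) : (altIndex r t j).1 ≤ 1 := by
  unfold altIndex; split_ifs <;> simp

theorem altIndex_snd_lt {r t j : ℕ} (ht : t ≤ r) (hj : j < 2 * r) : (altIndex r t j).2 < r := by
  unfold altIndex; split_ifs <;> dsimp only <;> omega

/-- `u_i` sits at position `i` if `i < t` and at `t + 2 (i - t)` otherwise; `v_i` sits at `t + 2 i +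
1` if `i < r - t` and at `i + r` otherwise. -/
theorem exists_altIndex_eq {r t e i : ℕ} (ht : t ≤ r) (he : e ≤ 1) (hi : i < r) :
    ∃ j < 2 * r, altIndex r t j = (e, i) := by
  obtain rfl | rfl : e = 0 ∨ e = 1 := by omega
  · by_cases h : i < t
    · exact ⟨i, by omega, by simp [altIndex, h]⟩
    · refine ⟨t + 2 * (i - t), by omega, ?_⟩
      rw [altIndex, if_neg (by omega), if_pos (by omega), if_pos (by omega), Prod.mk.injEq]
      omega
  · by_cases h : i < r - t
    · refine ⟨t + 2 * i + 1, by omega, ?_⟩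
      rw [altIndex, if_neg (by omega), if_pos (by omega), if_neg (by omega), Prod.mk.injEq]
      omega
    · refine ⟨i + r, by omega, ?_⟩
      rw [altIndex, if_neg (by omega), if_neg (by omega), Prod.mk.injEq]
      omega

/-- Column numbers at level `m - 1` and their digits. -/
theorem column_lt {n m s ℓ e : ℕ} (hm : 1 ≤ m) (hmn : m ≤ n) (hs : s < 2 ^ (m - 1))
    (hℓ : ℓ < 2 ^ (n - m)) (he : e ≤ 1) : s + (2 * ℓ + e) * 2 ^ (m - 1) < 2 ^ n := by
  have h : 2 ^ n = 2 * 2 ^ (n - m) * 2 ^ (m - 1) := by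
    rw [← pow_succ', ← pow_add]; congr 1; omega
  rw [h]
  calc s + (2 * ℓ + e) * 2 ^ (m - 1) < (2 * ℓ + e + 1) * 2 ^ (m - 1) := by linarith
    _ ≤ _ := Nat.mul_le_mul_right _ (by omega)

theorem flattenSource_mem {n m : ℕ} (hm : 1 ≤ m) (hmn : m ≤ n) (x : ColIdx n m) :
    flattenSource n m x ∈ E n (m - 1) := by
  obtain ⟨ℓ, s, y⟩ := x
  have hp := pos_lt y
  rw [mem_E]
  simp only [flattenSource, columnEntry]
  have h2 := altIndex_snd_lt (r := 2 ^ n + s) (t := s) (j := pos y) (by omega) (by omega)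
  have h1 := altIndex_fst_le (2 ^ n + s) s (pos y)
  refine ⟨column_lt hm hmn s.2 ℓ.2 h1, ?_, by omega⟩
  rw [Nat.add_mul_mod_self_right, Nat.mod_eq_of_lt s.2]
  have : ((altIndex (2 ^ n + s) s (pos y)).2 : ℤ) < 2 ^ n + s := by exact_mod_cast h2
  omega

/-- The column number is a digit expansion with digits `s < 2 ^ (m - 1)`, `e ≤ 1` and `ℓ`, so it
determines all three; the height then determines the index within the column. -/
theorem flattenSource_injective {n m : ℕ} : Function.Injective (flattenSource n m) := by
  rintro ⟨ℓ, s, y⟩ ⟨ℓ', s', y'⟩ h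
  simp only [flattenSource, columnEntry, Prod.mk.injEq] at h
  obtain ⟨h1, h2⟩ := h
  have hs : (s : ℕ) = s' := by
    have := congrArg (· % 2 ^ (m - 1)) h2
    simpa [Nat.add_mul_mod_self_right, Nat.mod_eq_of_lt s.2, Nat.mod_eq_of_lt s'.2] using this
  obtain rfl : s = s' := Fin.ext hs
  have h3 := Nat.eq_of_mul_eq_mul_right (by positivity) (Nat.add_left_cancel h2)
  have b := altIndex_fst_le (2 ^ n + s) s (pos y)
  have b' := altIndex_fst_le (2 ^ n + s) s (pos y')
  obtain rfl : ℓ = ℓ' := Fin.ext (by omega)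
  have h5 : altIndex (2 ^ n + s) s (pos y) = altIndex (2 ^ n + s) s (pos y') :=
    Prod.ext (by omega) (by omega)
  rw [pos_injective (altIndex_injective (Nat.le_add_left _ _) h5)]

theorem exists_flattenSource_eq {n m : ℕ} (hm : 1 ≤ m) (hmn : m ≤ n) {p : ℤ × ℕ}
    (hp : p ∈ E n (m - 1)) : ∃ x, flattenSource n m x = p := by
  obtain ⟨h, c⟩ := p
  rw [mem_E] at hp
  dsimp only at hp
  obtain ⟨hc, hh, hh'⟩ := hp
  set s := c % 2 ^ (m - 1) with hs
  have hsl : s < 2 ^ (m - 1) := Nat.mod_lt _ (by positivity)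
  have hℓ : c / 2 ^ (m - 1) / 2 < 2 ^ (n - m) := by
    rw [Nat.div_div_eq_div_mul]
    refine Nat.div_lt_of_lt_mul (hc.trans_eq ?_)
    rw [← pow_succ, ← pow_add]; congr 1; omega
  have hi : (2 ^ n - 1 - h).toNat < 2 ^ n + s := by
    zify; rw [Int.toNat_of_nonneg (by linarith)]; linarith
  obtain ⟨j, hj, hje⟩ := exists_altIndex_eq (r := 2 ^ n + s) (t := s)
    (e := c / 2 ^ (m - 1) % 2) (by omega) (by omega) hi
  obtain ⟨y, hy⟩ := exists_pos_eq (a := s) (b := 2 * 2 ^ n) (c := s) (j := j) (by omega)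
  refine ⟨⟨⟨_, hℓ⟩, ⟨s, hsl⟩, y⟩, ?_⟩
  simp only [flattenSource, columnEntry, hy, hje, Prod.mk.injEq, Nat.div_add_mod]
  refine ⟨by rw [Int.toNat_of_nonneg (by linarith)]; ring, ?_⟩
  rw [hs, mul_comm, Nat.mod_add_div]

theorem unflattenTarget_mem {n m : ℕ} (hm : 1 ≤ m) (hmn : m ≤ n) (y : RowIdx n m) :
    unflattenTarget n m y ∈ E n m := by
  obtain ⟨ℓ, s, y⟩ := y
  have hp := pos_lt y
  have h2 := altIndex_snd_lt (r := 2 ^ n + 2 * s + 1) (t := 0) (j := pos y) (by omega) (by omega)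
  have h1 := altIndex_fst_le (2 ^ n + 2 * s + 1) 0 (pos y)
  -- The row block stops one short of `2 r`, so the last entry of the second column is never
  -- reached. This accounts for column `2 s` being one entry shorter than column `2 s + 1`.
  have h3 : (altIndex (2 ^ n + 2 * s + 1) 0 (pos y)).2 +
      (altIndex (2 ^ n + 2 * s + 1) 0 (pos y)).1 < 2 ^ n + 2 * s + 1 := by
    unfold altIndex; split_ifs <;> dsimp only <;> omega
  rw [mem_E]
  simp only [unflattenTarget, columnEntry]
  generalize altIndex (2 ^ n + 2 * s + 1) 0 (pos y) = c at *
  have hpm : 2 ^ m = 2 * 2 ^ (m - 1) := by rw [← pow_succ']; congr 1; omega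
  have hs := s.2
  have hlt : 2 * (s : ℕ) + 1 - c.1 < 2 ^ m := by omega
  refine ⟨?_, ?_, by omega⟩
  · have hpn : 2 ^ n = 2 ^ (n - m) * 2 ^ m := by rw [← pow_add]; congr 1; omega
    calc (ℓ : ℕ) * 2 ^ m + (2 * s + 1 - c.1) < (ℓ + 1) * 2 ^ m := by linarith
      _ ≤ _ := hpn ▸ Nat.mul_le_mul_right _ ℓ.2
  · rw [Nat.mul_add_mod_self_right, Nat.mod_eq_of_lt hlt]
    have : (c.2 : ℤ) + c.1 < 2 ^ n + 2 * s + 1 := by exact_mod_cast h3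
    omega

theorem unflattenTarget_injective {n m : ℕ} (hm : 1 ≤ m) :
    Function.Injective (unflattenTarget n m) := by
  rintro ⟨ℓ, s, y⟩ ⟨ℓ', s', y'⟩ h
  simp only [unflattenTarget, columnEntry, Prod.mk.injEq] at h
  obtain ⟨h1, h2⟩ := h
  have b := altIndex_fst_le (2 ^ n + 2 * s + 1) 0 (pos y)
  have b' := altIndex_fst_le (2 ^ n + 2 * s' + 1) 0 (pos y')
  have hpm : 2 ^ m = 2 * 2 ^ (m - 1) := by rw [← pow_succ']; congr 1; omega
  have hs := s.2
  have hs' := s'.2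
  have h3 := congrArg (· % 2 ^ m) h2
  simp only [Nat.mul_add_mod_self_right] at h3
  rw [Nat.mod_eq_of_lt (by omega), Nat.mod_eq_of_lt (by omega)] at h3
  rw [h3] at h2
  have h4 := Nat.eq_of_mul_eq_mul_right (by positivity) (Nat.add_right_cancel h2)
  obtain rfl : s = s' := Fin.ext (by omega)
  obtain rfl : ℓ = ℓ' := Fin.ext h4
  have h5 : altIndex (2 ^ n + 2 * s + 1) 0 (pos y) = altIndex (2 ^ n + 2 * s + 1) 0 (pos y') :=
    Prod.ext (by omega) (by omega)
  rw [pos_injective (altIndex_injective (Nat.zero_le _) h5)]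

theorem exists_unflattenTarget_eq {n m : ℕ} (hm : 1 ≤ m) (hmn : m ≤ n) {p : ℤ × ℕ}
    (hp : p ∈ E n m) : ∃ y, unflattenTarget n m y = p := by
  obtain ⟨h, c⟩ := p
  rw [mem_E] at hp
  dsimp only at hp
  obtain ⟨hc, hh, hh'⟩ := hp
  have hpm : 2 ^ m = 2 * 2 ^ (m - 1) := by rw [← pow_succ']; congr 1; omega
  have hsl : c % 2 ^ m / 2 < 2 ^ (m - 1) := by
    have := Nat.mod_lt c (show 0 < 2 ^ m by positivity)
    omega
  set s := c % 2 ^ m / 2 with hs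
  have hℓ : c / 2 ^ m < 2 ^ (n - m) := by
    refine Nat.div_lt_of_lt_mul (hc.trans_eq ?_)
    rw [← pow_add]; congr 1; omega
  have hi : (2 ^ n - 1 - h).toNat < 2 ^ n + c % 2 ^ m := by
    zify; rw [Int.toNat_of_nonneg (by linarith)]; push_cast at hh; linarith
  obtain ⟨j, hj, hje⟩ := exists_altIndex_eq (r := 2 ^ n + 2 * s + 1) (t := 0)
    (e := 1 - c % 2 ^ m % 2) (i := (2 ^ n - 1 - h).toNat) (by omega) (by omega) (by omega)
  -- Position `2 r - 1` would be the dropped entry of the even column, whose height lies below the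
  -- index set; `hi` excludes it.
  have hj' : j < 2 * s + (2 * 2 ^ n + 1) + 2 * s := by
    unfold altIndex at hje
    split_ifs at hje <;> simp only [Prod.mk.injEq] at hje <;> omega
  obtain ⟨y, hy⟩ := exists_pos_eq (a := 2 * s) (b := 2 * 2 ^ n + 1) (c := 2 * s) hj'
  refine ⟨⟨⟨_, hℓ⟩, ⟨s, hsl⟩, y⟩, ?_⟩
  simp only [unflattenTarget, columnEntry, hy, hje, Prod.mk.injEq]
  refine ⟨by rw [Int.toNat_of_nonneg (by linarith)]; ring, ?_⟩
  rw [show 2 * s + 1 - (1 - c % 2 ^ m % 2) = c % 2 ^ m by omega, mul_comm, Nat.div_add_mod]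

/-- The flattening permutation as an equivalence. -/
noncomputable def flattenEquiv {n m : ℕ} (hm : 1 ≤ m) (hmn : m ≤ n) : ColIdx n m ≃ E n (m - 1) :=
  Equiv.ofBijective (fun x => ⟨flattenSource n m x, flattenSource_mem hm hmn x⟩)
    ⟨fun _ _ h => flattenSource_injective (congrArg Subtype.val h), fun p => by
      obtain ⟨x, hx⟩ := exists_flattenSource_eq hm hmn p.2
      exact ⟨x, Subtype.ext hx⟩⟩

/-- The unflattening permutation as an equivalence. -/
noncomputable def unflattenEquiv {n m : ℕ} (hm : 1 ≤ m) (hmn : m ≤ n) : RowIdx n m ≃ E n m :=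
  Equiv.ofBijective (fun y => ⟨unflattenTarget n m y, unflattenTarget_mem hm hmn y⟩)
    ⟨fun _ _ h => unflattenTarget_injective hm (congrArg Subtype.val h), fun p => by
      obtain ⟨y, hy⟩ := exists_unflattenTarget_eq hm hmn p.2
      exact ⟨y, Subtype.ext hy⟩⟩

/-- Written as a reindexing, the permutation drops out of the orthonormality proofs and costs no
arithmetic operations. -/
theorem permP_transpose_mul {n m : ℕ} (hm : 1 ≤ m) (hmn : m ≤ n) {κ : Type*}
    (A : Matrix (ColIdx n m) κ ℝ) :
    (permP n m).transpose * A = A.submatrix (flattenEquiv hm hmn).symm id := by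
  ext e k
  rw [Matrix.mul_apply, Finset.sum_eq_single ((flattenEquiv hm hmn).symm e)]
  · have : (e : ℤ × ℕ) = flattenSource n m ((flattenEquiv hm hmn).symm e) :=
      congrArg Subtype.val ((flattenEquiv hm hmn).apply_symm_apply e).symm
    simp [permP, ← this]
  · intro x _ hx
    simp only [permP, Matrix.transpose_apply, Matrix.of_apply]
    rw [if_neg, zero_mul]
    intro h
    exact hx ((Equiv.eq_symm_apply _).2 (Subtype.ext h.symm))
  · simp

theorem permQ_mul {n m : ℕ} (hm : 1 ≤ m) (hmn : m ≤ n) {κ : Type*}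
    (A : Matrix (RowIdx n m) κ ℝ) :
    permQ n m * A = A.submatrix (unflattenEquiv hm hmn).symm id := by
  ext e k
  rw [Matrix.mul_apply, Finset.sum_eq_single ((unflattenEquiv hm hmn).symm e)]
  · have : (e : ℤ × ℕ) = unflattenTarget n m ((unflattenEquiv hm hmn).symm e) :=
      congrArg Subtype.val ((unflattenEquiv hm hmn).apply_symm_apply e).symm
    simp [permQ, ← this]
  · intro x _ hx
    simp only [permQ, Matrix.of_apply]
    rw [if_neg, zero_mul]
    intro h
    exact hx ((Equiv.eq_symm_apply _).2 (Subtype.ext h.symm))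
  · simp

/-! ### Products of block matrices -/

theorem diag3_mul_diag3 {a₁ a₂ a₃ b₁ b₂ b₃ c₁ c₂ c₃ : Type*} [Fintype a₂] [Fintype b₂] [Fintype c₂]
    (A : Matrix a₁ a₂ ℝ) (B : Matrix b₁ b₂ ℝ) (C : Matrix c₁ c₂ ℝ)
    (A' : Matrix a₂ a₃ ℝ) (B' : Matrix b₂ b₃ ℝ) (C' : Matrix c₂ c₃ ℝ) :
    diag3 A B C * diag3 A' B' C' = diag3 (A * A') (B * B') (C * C') := by
  simp [diag3, Matrix.fromBlocks_multiply]

theorem diag3_transpose {a₁ a₂ b₁ b₂ c₁ c₂ : Type*} (A : Matrix a₁ a₂ ℝ) (B : Matrix b₁ b₂ ℝ)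
    (C : Matrix c₁ c₂ ℝ) :
    (diag3 A B C).transpose = diag3 A.transpose B.transpose C.transpose := by
  simp [diag3, Matrix.fromBlocks_transpose]

theorem diag3_one {a b c : Type*} [DecidableEq a] [DecidableEq b] [DecidableEq c] :
    diag3 (1 : Matrix a a ℝ) (1 : Matrix b b ℝ) (1 : Matrix c c ℝ) = 1 := by
  simp [diag3, Matrix.fromBlocks_one]

theorem one_kronecker_transpose {ι κ K : Type*} [DecidableEq K] (A : Matrix ι κ ℝ) :
    ((1 : Matrix K K ℝ) ⊗ₖ A).transpose = 1 ⊗ₖ A.transpose := by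
  ext i j
  simp [Matrix.one_apply, eq_comm]

theorem one_kronecker_mulVec {ι κ K : Type*} [Fintype κ] [Fintype K] [DecidableEq K]
    (A : Matrix ι κ ℝ) (x : K × κ → ℝ) (i : K × ι) :
    ((1 : Matrix K K ℝ) ⊗ₖ A).mulVec x i = A.mulVec (fun j => x (i.1, j)) i.2 := by
  simp only [Matrix.mulVec, dotProduct, Fintype.sum_prod_type]
  rw [Finset.sum_eq_single i.1]
  · simp
  · intro b _ hb
    simp [hb.symm]
  · simp

theorem blockDiagonal'_mulVec {o : Type*} [Fintype o] [DecidableEq o] {ι κ : o → Type*}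
    [∀ b, Fintype (κ b)] (A : ∀ b, Matrix (ι b) (κ b) ℝ) (x : (b : o) × κ b → ℝ)
    (b : o) (i : ι b) :
    (Matrix.blockDiagonal' A).mulVec x ⟨b, i⟩ = (A b).mulVec (fun j => x ⟨b, j⟩) i := by
  simp only [Matrix.mulVec, dotProduct, Fintype.sum_sigma]
  rw [Finset.sum_eq_single b]
  · simp [Matrix.blockDiagonal'_apply_eq]
  · intro c _ hc
    exact Finset.sum_eq_zero fun j _ => by
      rw [Matrix.blockDiagonal'_apply_ne _ _ _ hc.symm, zero_mul]
  · simp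

section diag3

variable {a₁ a₂ b₁ b₂ c₁ c₂ : Type*} [Fintype a₂] [Fintype b₂] [Fintype c₂]
  (A : Matrix a₁ a₂ ℝ) (B : Matrix b₁ b₂ ℝ) (C : Matrix c₁ c₂ ℝ) (x : a₂ ⊕ b₂ ⊕ c₂ → ℝ)

theorem diag3_mulVec_inl (i : a₁) :
    (diag3 A B C).mulVec x (Sum.inl i) = A.mulVec (fun j => x (Sum.inl j)) i := by
  simp [diag3, Matrix.mulVec, dotProduct]

theorem diag3_mulVec_inr_inl (i : b₁) :
    (diag3 A B C).mulVec x (Sum.inr (Sum.inl i)) =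
      B.mulVec (fun j => x (Sum.inr (Sum.inl j))) i := by
  simp [diag3, Matrix.mulVec, dotProduct]

theorem diag3_mulVec_inr_inr (i : c₁) :
    (diag3 A B C).mulVec x (Sum.inr (Sum.inr i)) =
      C.mulVec (fun j => x (Sum.inr (Sum.inr j))) i := by
  simp [diag3, Matrix.mulVec, dotProduct]

end diag3

/-! ### The singular value decomposition -/

theorem sum_range_two_mul_div_two {M : Type*} [AddCommMonoid M] (f : ℕ → M) (s : ℕ) :
    ∑ i ∈ Finset.range (2 * s), f (i / 2) = ∑ i ∈ Finset.range s, (f i + f i) := by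
  induction s with
  | zero => simp
  | succ s ih =>
    rw [show 2 * (s + 1) = 2 * s + 1 + 1 by ring, Finset.sum_range_succ, Finset.sum_range_succ,
      ih, Finset.sum_range_succ, show 2 * s / 2 = s by omega, show (2 * s + 1) / 2 = s by omega,
      add_assoc]

theorem H_transpose_mul_self (s : ℕ) : (H s).transpose * H s = (2 : ℝ) • 1 := by
  ext j k
  simp only [Matrix.mul_apply, Matrix.transpose_apply, H, Matrix.of_apply]
  rw [← Finset.sum_range fun i => (if i / 2 = (j : ℕ) then (1 : ℝ) else 0) *
    (if i / 2 = (k : ℕ) then 1 else 0),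
    sum_range_two_mul_div_two fun i => (if i = (j : ℕ) then (1 : ℝ) else 0) *
    (if i = (k : ℕ) then 1 else 0)]
  rw [Finset.sum_eq_single (j : ℕ)]
  · by_cases h : j = k
    · subst h; norm_num
    · have : (j : ℕ) ≠ k := fun e => h (Fin.ext e)
      simp [h, this]
  · intro b _ hb; simp [hb]
  · simp

theorem H_mulVec (s : ℕ) (w : Fin s → ℝ) (i : Fin (2 * s)) :
    (H s).mulVec w i = w ⟨(i : ℕ) / 2, by omega⟩ := by
  simp only [Matrix.mulVec, dotProduct, H, Matrix.of_apply, ite_mul, one_mul, zero_mul]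
  rw [sum_ite_val_eq, dif_pos]

theorem convMatrix_mulVec (t : ℕ) (w : Fin t → ℝ) (j : Fin (t + 1)) :
    (convMatrix t).mulVec w j = (if h : (j : ℕ) < t then w ⟨j, h⟩ else 0) +
      if h : 0 < (j : ℕ) then w ⟨j - 1, by omega⟩ else 0 := by
  simp only [Matrix.mulVec, dotProduct, convMatrix, Matrix.of_apply, add_mul, ite_mul, one_mul,
    zero_mul, Finset.sum_add_distrib]
  congr 1
  · exact sum_ite_val_eq _ _
  · obtain ⟨j, hj⟩ := j
    cases j with
    | zero => simp
    | succ j =>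
      simp only [add_left_inj]
      rw [sum_ite_val_eq, dif_pos (by omega), dif_pos (by omega)]
      rfl

/-- The matrix of the ADRT level on a flattened block. -/
def blockConv (N s : ℕ) : Matrix (RowBlock N s) (ColBlock N s) ℝ :=
  diag3 (H s) (convMatrix (2 * N)) (H s)

/-- The matrix of the ADRT level between flattened data. -/
noncomputable def levelConv (n m : ℕ) : Matrix (RowIdx n m) (ColIdx n m) ℝ :=
  (1 : Matrix (Fin (2 ^ (n - m))) (Fin (2 ^ (n - m))) ℝ) ⊗ₖ
    Matrix.blockDiagonal' fun s : Fin (2 ^ (m - 1)) => blockConv (2 ^ n) s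

theorem blockU_mul_blockSigma_mul_blockV_transpose (N s : ℕ) :
    blockU N s * blockSigma N s * (blockV N s).transpose = blockConv N s := by
  rw [blockU, blockSigma, blockV, diag3_transpose, diag3_mul_diag3, diag3_mul_diag3,
    dstU_mul_dstSigma_mul_dstV_transpose, blockConv]
  simp [smul_smul]

theorem blockU_transpose_mul_self (N s : ℕ) : (blockU N s).transpose * blockU N s = 1 := by
  have h2 : (√(2 : ℝ))⁻¹ * (√2)⁻¹ * 2 = 1 := by
    rw [← mul_inv, Real.mul_self_sqrt two_pos.le]; norm_num
  rw [blockU, diag3_transpose, diag3_mul_diag3, dstU_transpose_mul_self, Matrix.transpose_smul,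
    Matrix.smul_mul, Matrix.mul_smul, H_transpose_mul_self, smul_smul, smul_smul, h2, one_smul,
    diag3_one]

theorem blockV_transpose_mul_self (N s : ℕ) : (blockV N s).transpose * blockV N s = 1 := by
  rw [blockV, diag3_transpose, diag3_mul_diag3, dstV_transpose_mul_self, Matrix.transpose_one,
    one_mul, diag3_one]

/-- The diagonal of `blockSigma`. -/
noncomputable def blockSingularValue (N s : ℕ) : ColBlock N s → ℝ :=
  Sum.elim (fun _ => √2) (Sum.elim (fun k => dstSigma (2 * N) k k) fun _ => √2)

theorem blockSigma_eq_diagonal (N s : ℕ) :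
    blockSigma N s = Matrix.diagonal (blockSingularValue N s) := by
  rw [blockSigma, diag3, ← Matrix.diagonal_one, ← Matrix.diagonal_smul]
  have : dstSigma (2 * N) = Matrix.diagonal fun k => dstSigma (2 * N) k k := by
    simp [dstSigma]
  rw [this, Matrix.fromBlocks_diagonal, Matrix.fromBlocks_diagonal, blockSingularValue]
  congr 1
  ext (x | x | x) <;> simp

theorem blockSingularValue_pos (N s : ℕ) (x : ColBlock N s) : 0 < blockSingularValue N s x := by
  rcases x with x | x | x
  · exact Real.sqrt_pos.2 two_pos
  · exact dstSigma_pos _ _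
  · exact Real.sqrt_pos.2 two_pos

theorem levelU_mul_levelSigma_mul_levelV_transpose (n m : ℕ) :
    levelU n m * levelSigma n m * (levelV n m).transpose = levelConv n m := by
  simp only [levelU, levelSigma, levelV, levelConv, one_kronecker_transpose,
    Matrix.blockDiagonal'_transpose]
  rw [← Matrix.mul_kronecker_mul, ← Matrix.mul_kronecker_mul, ← Matrix.blockDiagonal'_mul,
    ← Matrix.blockDiagonal'_mul]
  simp [blockU_mul_blockSigma_mul_blockV_transpose]

theorem levelU_transpose_mul_self (n m : ℕ) : (levelU n m).transpose * levelU n m = 1 := by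
  simp only [levelU, one_kronecker_transpose, Matrix.blockDiagonal'_transpose]
  rw [← Matrix.mul_kronecker_mul, ← Matrix.blockDiagonal'_mul]
  simp only [blockU_transpose_mul_self, one_mul]
  exact (congrArg _ Matrix.blockDiagonal'_one).trans Matrix.one_kronecker_one

theorem levelV_transpose_mul_self (n m : ℕ) : (levelV n m).transpose * levelV n m = 1 := by
  simp only [levelV, one_kronecker_transpose, Matrix.blockDiagonal'_transpose]
  rw [← Matrix.mul_kronecker_mul, ← Matrix.blockDiagonal'_mul]
  simp only [blockV_transpose_mul_self, one_mul]
  exact (congrArg _ Matrix.blockDiagonal'_one).trans Matrix.one_kronecker_one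

theorem levelSigma_eq_diagonal (n m : ℕ) :
    levelSigma n m = Matrix.diagonal fun x => blockSingularValue (2 ^ n) x.2.1 x.2.2 := by
  simp only [levelSigma, blockSigma_eq_diagonal]
  rw [Matrix.blockDiagonal'_diagonal, ← Matrix.diagonal_one, Matrix.diagonal_kronecker_diagonal]
  simp

theorem fullSigma_eq_diagonal (n m : ℕ) :
    fullSigma n m = Matrix.diagonal fun x => blockSingularValue (2 ^ n) x.2.2.1 x.2.2.2 := by
  rw [fullSigma, levelSigma_eq_diagonal, ← Matrix.diagonal_one,
    Matrix.diagonal_kronecker_diagonal]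
  simp

theorem levelConv_mulVec (n m : ℕ) (w : ColIdx n m → ℝ) (ℓ : Fin (2 ^ (n - m)))
    (s : Fin (2 ^ (m - 1))) (y : RowBlock (2 ^ n) s) :
    (levelConv n m).mulVec w (ℓ, ⟨s, y⟩) =
      (blockConv (2 ^ n) s).mulVec (fun z => w (ℓ, ⟨s, z⟩)) y := by
  rw [levelConv, one_kronecker_mulVec, blockDiagonal'_mulVec]

theorem sectionEntry_eq_zero {n m : ℕ} (f : E n m → ℝ) {ℓ : ℕ} {h : ℤ} {s : ℕ} (hs : s < 2 ^ m)
    (hh : h < -s ∨ 2 ^ n ≤ h) : sectionEntry f ℓ h s = 0 := by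
  rw [sectionEntry, dif_neg]
  rw [mem_E]
  rintro ⟨-, h1, h2⟩
  dsimp only at h1 h2
  rw [Nat.add_mul_mod_self_right, Nat.mod_eq_of_lt hs] at h1
  rcases hh with hh | hh <;> linarith

theorem apply_flattenEquiv {n m : ℕ} (hm : 1 ≤ m) (hmn : m ≤ n) (f : E n (m - 1) → ℝ)
    (ℓ : Fin (2 ^ (n - m))) (s : Fin (2 ^ (m - 1))) (z : ColBlock (2 ^ n) s) :
    f (flattenEquiv hm hmn (ℓ, ⟨s, z⟩)) =
      sectionEntry f (2 * ℓ + (altIndex (2 ^ n + s) s (pos z)).1)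
        (columnEntry n (altIndex (2 ^ n + s) s (pos z)).2) s := by
  rw [sectionEntry]
  symm
  exact dif_pos (flattenSource_mem hm hmn (ℓ, ⟨s, z⟩))

/-- Alternation without shift puts at position `j` the entry number `j / 2` of a column, and the odd
column comes first; hence `ε = 1 - j % 2`. -/
theorem singleLevel_apply_unflattenEquiv {n m : ℕ} (hm : 1 ≤ m) (hmn : m ≤ n)
    (f : E n (m - 1) → ℝ) (ℓ : Fin (2 ^ (n - m))) (s : Fin (2 ^ (m - 1)))
    (y : RowBlock (2 ^ n) s) :
    singleLevel n m f (unflattenEquiv hm hmn (ℓ, ⟨s, y⟩)) =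
      sectionEntry f (2 * ℓ) (2 ^ n - 1 - (pos y / 2 : ℕ)) s +
      sectionEntry f (2 * ℓ + 1)
        (2 ^ n - 1 - (pos y / 2 : ℕ) + s + (1 - pos y % 2 : ℕ)) s := by
  have hp := pos_lt y
  have hc : altIndex (2 ^ n + 2 * s + 1) 0 (pos y) = (pos y % 2, pos y / 2) := by
    unfold altIndex
    split_ifs <;> simp only [Prod.mk.injEq] <;> omega
  have hpm : 2 ^ m = 2 * 2 ^ (m - 1) := by rw [← pow_succ']; congr 1; omega
  have hs := s.2
  have hlt : 2 * (s : ℕ) + 1 - pos y % 2 < 2 ^ m := by omega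
  have hval : ((unflattenEquiv hm hmn (ℓ, ⟨s, y⟩) : E n m) : ℤ × ℕ) =
      ((2 : ℤ) ^ n - 1 - (pos y / 2 : ℕ), (ℓ : ℕ) * 2 ^ m + (2 * s + 1 - pos y % 2)) := by
    change unflattenTarget n m (ℓ, ⟨s, y⟩) = _
    simp only [unflattenTarget, columnEntry, hc]
  simp only [singleLevel, LinearMap.coe_mk, AddHom.coe_mk, hval]
  rw [Nat.mul_add_mod_self_right, Nat.mod_eq_of_lt hlt,
    show ((ℓ : ℕ) * 2 ^ m + (2 * s + 1 - pos y % 2)) / 2 ^ m = ℓ by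
      rw [mul_comm, Nat.mul_add_div (by positivity), Nat.div_eq_of_lt hlt, add_zero],
    show (2 * (s : ℕ) + 1 - pos y % 2) / 2 = s by omega,
    show (2 * (s : ℕ) + 1 - pos y % 2) % 2 = 1 - pos y % 2 by omega]

theorem singleLevel_apply_eq_levelConv_mulVec {n m : ℕ} (hm : 1 ≤ m) (hmn : m ≤ n)
    (f : E n (m - 1) → ℝ) (y : RowIdx n m) :
    singleLevel n m f (unflattenEquiv hm hmn y) =
      (levelConv n m).mulVec (fun x => f (flattenEquiv hm hmn x)) y := by
  obtain ⟨ℓ, s, y⟩ := y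
  have hs := s.2
  have hN : ((2 ^ n : ℕ) : ℤ) = 2 ^ n := by push_cast; rfl
  rw [levelConv_mulVec, singleLevel_apply_unflattenEquiv, blockConv]
  simp only [apply_flattenEquiv, columnEntry]
  rcases y with y | y | y
  · rw [diag3_mulVec_inl, H_mulVec]
    have hy := y.2
    have hc : altIndex (2 ^ n + s) s ((y : ℕ) / 2) = (0, (y : ℕ) / 2) := by
      rw [altIndex, if_pos (by omega)]
    simp only [pos, hc, add_zero]
    -- In the top part the second column is read at a height of at least `2 ^ n`.
    rw [sectionEntry_eq_zero (ℓ := 2 * ℓ + 1) f hs (by right; omega), add_zero]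
  · rw [diag3_mulVec_inr_inl, convMatrix_mulVec]
    have hy := y.2
    have hc : ∀ j : ℕ, j < 2 * 2 ^ n → altIndex (2 ^ n + s) s (s + j) =
        (j % 2, if j % 2 = 0 then s + j / 2 else j / 2) := by
      intro j hj
      rw [altIndex, if_neg (by omega), if_pos (by omega), Nat.add_sub_cancel_left]
      split_ifs with h
      · rw [h]
      · rw [show j % 2 = 1 by omega]
    simp only [pos]
    rw [show (2 * (s : ℕ) + y) / 2 = s + y / 2 by omega,
      show (2 * (s : ℕ) + y) % 2 = y % 2 by omega]
    -- For even `y` the entry `y` of the middle part comes from the first column and the entry `y -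
    -- 1` from the second; for odd `y` the roles are exchanged. The missing neighbours at `y = 2 N`
    -- and `y = 0` are reads at heights `-s - 1` and `N`, outside the data.
    by_cases he : (y : ℕ) % 2 = 0
    · congr 1
      · split_ifs with h
        · rw [hc _ h, if_pos he, he, add_zero]
        · exact sectionEntry_eq_zero f hs (by left; omega)
      · split_ifs with h
        · rw [hc _ (by omega), if_neg (by omega), show ((y : ℕ) - 1) % 2 = 1 by omega]
          congr 1
          omega
        · exact sectionEntry_eq_zero f hs (by right; omega)
    · rw [add_comm]
      congr 1
      · rw [dif_pos (by omega), hc _ (by omega), if_neg he, show (y : ℕ) % 2 = 1 by omega]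
        congr 1
        push_cast
        omega
      · rw [dif_pos (by omega), hc _ (by omega), if_pos (by omega),
          show ((y : ℕ) - 1) % 2 = 0 by omega, add_zero,
          show ((y : ℕ) - 1) / 2 = y / 2 by omega]
  · rw [diag3_mulVec_inr_inr, H_mulVec]
    have hy := y.2
    have hc : altIndex (2 ^ n + s) s (s + 2 * 2 ^ n + (y : ℕ) / 2) = (1, 2 ^ n + (y : ℕ) / 2) := by
      rw [altIndex, if_neg (by omega), if_neg (by omega), Prod.mk.injEq]
      omega
    simp only [pos, hc]
    -- In the bottom part the first column is read below `-s`.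
    rw [sectionEntry_eq_zero (ℓ := 2 * ℓ) f hs (by left; omega), zero_add]
    congr 1
    omega

theorem toMatrix'_singleLevel {n m : ℕ} (hm : 1 ≤ m) (hmn : m ≤ n) :
    LinearMap.toMatrix' (singleLevel n m) = permQ n m * levelConv n m * permP n m := by
  have h : permQ n m * levelConv n m * permP n m =
      (levelConv n m).submatrix (unflattenEquiv hm hmn).symm (flattenEquiv hm hmn).symm := by
    rw [Matrix.mul_assoc, permQ_mul hm hmn,
      -- Two transpositions turn right multiplication by the permutation into the left
      -- multiplication already treated.
      ← Matrix.transpose_transpose (levelConv n m * permP n m),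
      Matrix.transpose_mul, permP_transpose_mul hm hmn]
    rfl
  rw [h]
  ext e e'
  obtain ⟨y, rfl⟩ := (unflattenEquiv hm hmn).surjective e
  obtain ⟨x, rfl⟩ := (flattenEquiv hm hmn).surjective e'
  rw [LinearMap.toMatrix'_apply, singleLevel_apply_eq_levelConv_mulVec]
  simp only [Matrix.submatrix_apply, Equiv.symm_apply_apply, Matrix.mulVec, dotProduct,
    Pi.single_apply, EmbeddingLike.apply_eq_iff_eq, mul_ite, mul_one, mul_zero, Finset.sum_ite_eq',
    Finset.mem_univ, if_true]

theorem isSVD_fullLevel {n m : ℕ} (hm : 1 ≤ m) (hmn : m ≤ n) :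
    IsSVD (fullLevel n m) (fullU n m) (fullSigma n m) (fullV n m) where
  eq_mul := by
    rw [fullLevel, fullU, fullSigma, fullV, one_kronecker_transpose,
      ← Matrix.mul_kronecker_mul, ← Matrix.mul_kronecker_mul, toMatrix'_singleLevel hm hmn,
      ← levelU_mul_levelSigma_mul_levelV_transpose, Matrix.transpose_mul,
      Matrix.transpose_transpose]
    simp only [one_mul, Matrix.mul_assoc]
  left_orthonormal := by
    rw [fullU, one_kronecker_transpose, ← Matrix.mul_kronecker_mul, permQ_mul hm hmn,
      Matrix.transpose_submatrix, Matrix.submatrix_mul_equiv, levelU_transpose_mul_self]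
    simp
  right_orthonormal := by
    rw [fullV, one_kronecker_transpose, ← Matrix.mul_kronecker_mul,
      permP_transpose_mul hm hmn, Matrix.transpose_submatrix, Matrix.submatrix_mul_equiv,
      levelV_transpose_mul_self]
    simp
  isDiag := by
    rw [fullSigma_eq_diagonal]
    exact Matrix.isDiag_diagonal _
  diag_pos k := by
    rw [fullSigma_eq_diagonal, Matrix.diagonal_apply_eq]
    exact blockSingularValue_pos _ _ _

/-! ### Straight-line programs relative to available quantities -/

section Relative

variable {ι : Type*} {F G H' : Set ((ι → ℝ) → ℝ)} {k l : ℕ}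

/-- Every straight-line program that has computed the quantities in `F` can be extended by at most
`k` operations to one that has computed those in `G` as well. -/
def ComputableFrom (F : Set ((ι → ℝ) → ℝ)) (k : ℕ) (G : Set ((ι → ℝ) → ℝ)) : Prop :=
  ∀ j S, Computes j S → F ⊆ S → ∃ k' ≤ k, ∃ S', Computes (j + k') S' ∧ S ⊆ S' ∧ G ⊆ S'

theorem ComputableFrom.of_subset (h : G ⊆ F) : ComputableFrom F k G :=
  fun _ S hS hF => ⟨0, Nat.zero_le _, S, hS, subset_rfl, h.trans hF⟩

theorem ComputableFrom.mono {F' G' : Set ((ι → ℝ) → ℝ)} (h : ComputableFrom F k G) (hF : F ⊆ F')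
    (hkl : k ≤ l) (hG : G' ⊆ G) : ComputableFrom F' l G' := fun j S hS hF' => by
  obtain ⟨k', hk', S', h1, h2, h3⟩ := h j S hS (hF.trans hF')
  exact ⟨k', hk'.trans hkl, S', h1, h2, hG.trans h3⟩

theorem ComputableFrom.trans_union (h : ComputableFrom F k G)
    (h' : ComputableFrom (F ∪ G) l H') : ComputableFrom F (k + l) (G ∪ H') := fun j S hS hF => by
  obtain ⟨k', hk', S', h1, h2, h3⟩ := h j S hS hF
  obtain ⟨l', hl', S'', h1', h2', h3'⟩ := h' _ S' h1 (Set.union_subset (hF.trans h2) h3)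
  exact ⟨k' + l', by omega, S'', by rwa [← add_assoc], h2.trans h2',
    Set.union_subset (h3.trans h2') h3'⟩

theorem ComputableFrom.trans (h : ComputableFrom F k G) (h' : ComputableFrom G l H') :
    ComputableFrom F (k + l) H' :=
  (h.trans_union (h'.mono Set.subset_union_right le_rfl subset_rfl)).mono subset_rfl le_rfl
    Set.subset_union_right

theorem ComputableFrom.union (h : ComputableFrom F k G) (h' : ComputableFrom F l H') :
    ComputableFrom F (k + l) (G ∪ H') :=
  h.trans_union (h'.mono Set.subset_union_left le_rfl subset_rfl)

theorem ComputableFrom.biUnion {β : Type*} (s : Finset β) {c : β → ℕ}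
    {A : β → Set ((ι → ℝ) → ℝ)} (h : ∀ b ∈ s, ComputableFrom F (c b) (A b)) :
    ComputableFrom F (∑ b ∈ s, c b) (⋃ b ∈ s, A b) := by
  classical
  induction s using Finset.induction_on with
  | empty => exact .of_subset (by simp)
  | insert b s hb ih =>
    rw [Finset.sum_insert hb, Finset.set_biUnion_insert]
    exact (h b (Finset.mem_insert_self _ _)).union
      (ih fun b hb => h b (Finset.mem_insert_of_mem hb))

theorem ComputableFrom.range_of_forall {κ : Type*} [Fintype κ] {g : κ → (ι → ℝ) → ℝ}
    (h : ∀ i, ComputableFrom F k {g i}) : ComputableFrom F (Fintype.card κ * k) (Set.range g) := by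
  refine (ComputableFrom.biUnion Finset.univ fun i _ => h i).mono subset_rfl (by simp) ?_
  rintro _ ⟨i, rfl⟩
  simp

theorem ComputableFrom.add {f g : (ι → ℝ) → ℝ} (hf : f ∈ F) (hg : g ∈ F) :
    ComputableFrom F 1 {fun x => f x + g x} := fun _ _ hS hF =>
  ⟨1, le_rfl, _, hS.add (hF hf) (hF hg), Set.subset_insert _ _, by simp⟩

theorem ComputableFrom.sub {f g : (ι → ℝ) → ℝ} (hf : f ∈ F) (hg : g ∈ F) :
    ComputableFrom F 1 {fun x => f x - g x} := fun _ _ hS hF =>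
  ⟨1, le_rfl, _, hS.sub (hF hf) (hF hg), Set.subset_insert _ _, by simp⟩

theorem ComputableFrom.smul {f : (ι → ℝ) → ℝ} (c : ℝ) (hf : f ∈ F) :
    ComputableFrom F 1 {fun x => c * f x} := fun _ _ hS hF =>
  ⟨1, le_rfl, _, hS.smul c (hF hf), Set.subset_insert _ _, by simp⟩

/-- Programs can be run on quantities that are available already. -/
theorem Computes.comp {κ : Type*} {S : Set ((κ → ℝ) → ℝ)} (h : Computes k S)
    (g : κ → (ι → ℝ) → ℝ) :
    ComputableFrom (Set.range g) k ((fun f x => f fun j => g j x) '' S) := by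
  induction h with
  | input =>
    refine .of_subset ?_
    rintro _ ⟨_, ⟨i, rfl⟩, rfl⟩
    exact ⟨i, rfl⟩
  | add _ hf hg ih =>
    rw [Set.image_insert_eq, Set.insert_eq, Set.union_comm]
    exact ih.trans_union (.add (.inr ⟨_, hf, rfl⟩) (.inr ⟨_, hg, rfl⟩))
  | sub _ hf hg ih =>
    rw [Set.image_insert_eq, Set.insert_eq, Set.union_comm]
    exact ih.trans_union (.sub (.inr ⟨_, hf, rfl⟩) (.inr ⟨_, hg, rfl⟩))
  | smul c _ hf ih =>
    rw [Set.image_insert_eq, Set.insert_eq, Set.union_comm]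
    exact ih.trans_union (.smul c (.inr ⟨_, hf, rfl⟩))

end Relative

/-! ### Complex families -/

section Complex

variable {ι : Type*}

/-- The real and imaginary parts of the first `L` members of a family of complex quantities. -/
def reImParts (a : ℕ → (ι → ℝ) → ℂ) (L : ℕ) : Set ((ι → ℝ) → ℝ) :=
  ⋃ j ∈ Finset.range L, {fun x => (a j x).re, fun x => (a j x).im}

theorem re_mem_reImParts (a : ℕ → (ι → ℝ) → ℂ) {L j : ℕ} (hj : j < L) :
    (fun x => (a j x).re) ∈ reImParts a L :=
  Set.mem_biUnion (Finset.mem_coe.2 (Finset.mem_range.2 hj)) (by simp)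

theorem im_mem_reImParts (a : ℕ → (ι → ℝ) → ℂ) {L j : ℕ} (hj : j < L) :
    (fun x => (a j x).im) ∈ reImParts a L :=
  Set.mem_biUnion (Finset.mem_coe.2 (Finset.mem_range.2 hj)) (by simp)

theorem reImParts_subset {a : ℕ → (ι → ℝ) → ℂ} {L : ℕ} {F : Set ((ι → ℝ) → ℝ)}
    (h : ∀ j < L, (fun x => (a j x).re) ∈ F ∧ (fun x => (a j x).im) ∈ F) : reImParts a L ⊆ F := by
  intro f hf
  simp only [reImParts, Set.mem_iUnion, Finset.mem_range] at hf
  obtain ⟨j, hj, rfl | rfl⟩ := hf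
  exacts [(h j hj).1, (h j hj).2]

theorem ComputableFrom.reImParts_of_forall {F : Set ((ι → ℝ) → ℝ)} {c L : ℕ}
    {a : ℕ → (ι → ℝ) → ℂ}
    (h : ∀ j < L, ComputableFrom F c {fun x => (a j x).re, fun x => (a j x).im}) :
    ComputableFrom F (L * c) (reImParts a L) :=
  (ComputableFrom.biUnion (Finset.range L) fun j hj => h j (Finset.mem_range.1 hj)).mono
    subset_rfl (by simp) subset_rfl

/-- Four real multiplications by constants, one subtraction and one addition. -/
theorem ComputableFrom.complex_mul {F : Set ((ι → ℝ) → ℝ)} {a : (ι → ℝ) → ℂ} (w : ℂ)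
    (hre : (fun x => (a x).re) ∈ F) (him : (fun x => (a x).im) ∈ F) :
    ComputableFrom F 6 {fun x => (w * a x).re, fun x => (w * a x).im} := by
  simp only [Complex.mul_re, Complex.mul_im]
  have h1 := ((ComputableFrom.smul w.re hre).union (.smul w.im him)).trans
    (.sub (f := fun x => w.re * (a x).re) (g := fun x => w.im * (a x).im) (by simp) (by simp))
  have h2 := ((ComputableFrom.smul w.re him).union (.smul w.im hre)).trans
    (.add (f := fun x => w.re * (a x).im) (g := fun x => w.im * (a x).re) (by simp) (by simp))
  exact (h1.union h2).mono subset_rfl le_rfl (by rw [Set.insert_eq])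

theorem ComputableFrom.complex_add {F : Set ((ι → ℝ) → ℝ)} {a b : (ι → ℝ) → ℂ}
    (hre : (fun x => (a x).re) ∈ F) (him : (fun x => (a x).im) ∈ F)
    (hre' : (fun x => (b x).re) ∈ F) (him' : (fun x => (b x).im) ∈ F) :
    ComputableFrom F 2 {fun x => (a x + b x).re, fun x => (a x + b x).im} := by
  simp only [Complex.add_re, Complex.add_im]
  exact ((ComputableFrom.add hre hre').union (.add him him')).mono subset_rfl le_rfl
    (by rw [Set.insert_eq])

theorem ComputableFrom.complex_mul_family (a : ℕ → (ι → ℝ) → ℂ) (w : ℕ → ℂ) (L : ℕ) :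
    ComputableFrom (reImParts a L) (L * 6) (reImParts (fun j x => w j * a j x) L) :=
  .reImParts_of_forall fun j hj =>
    .complex_mul (a := a j) (w j) (re_mem_reImParts a hj) (im_mem_reImParts a hj)

theorem sum_range_two_mul {M : Type*} [AddCommMonoid M] (f : ℕ → M) (n : ℕ) :
    ∑ j ∈ Finset.range (2 * n), f j =
      ∑ j ∈ Finset.range n, f (2 * j) + ∑ j ∈ Finset.range n, f (2 * j + 1) := by
  induction n with
  | zero => simp
  | succ n ih =>
    rw [show 2 * (n + 1) = 2 * n + 1 + 1 by ring, Finset.sum_range_succ, Finset.sum_range_succ, ih,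
      Finset.sum_range_succ, Finset.sum_range_succ]
    abel

/-- The fast Fourier transform of length `2 ^ r`. -/
theorem ComputableFrom.fourier (r : ℕ) : ∀ (z : ℂ) (_ : z ^ 2 ^ r = 1) (a : ℕ → (ι → ℝ) → ℂ),
    ComputableFrom (reImParts a (2 ^ r)) (8 * r * 2 ^ r)
      (reImParts (fun k x => ∑ j ∈ Finset.range (2 ^ r), a j x * z ^ (j * k)) (2 ^ r)) := by
  induction r with
  | zero =>
    intro z _ a
    refine .of_subset (reImParts_subset fun j hj => ?_)
    simpa using ⟨re_mem_reImParts a (Nat.zero_lt_one), im_mem_reImParts a (Nat.zero_lt_one)⟩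
  | succ r ih =>
    intro z hz a
    have hz' : (z ^ 2) ^ 2 ^ r = 1 := by rw [← pow_mul, ← pow_succ', hz]
    have hpow : 2 ^ (r + 1) = 2 * 2 ^ r := pow_succ' _ _
    -- Radix two splitting: the even and odd subsequences are transformed with `z ^ 2`. Primitivity
    -- of `z` plays no role, only `z ^ 2 ^ r = 1`.
    set e : ℕ → (ι → ℝ) → ℂ := fun k x =>
      ∑ j ∈ Finset.range (2 ^ r), a (2 * j) x * (z ^ 2) ^ (j * k) with he
    set o : ℕ → (ι → ℝ) → ℂ := fun k x =>
      ∑ j ∈ Finset.range (2 ^ r), a (2 * j + 1) x * (z ^ 2) ^ (j * k) with ho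
    have h1 := (ih (z ^ 2) hz' fun j => a (2 * j)).mono (F' := reImParts a (2 ^ (r + 1)))
      (reImParts_subset fun j hj => ⟨re_mem_reImParts a (by omega), im_mem_reImParts a (by omega)⟩)
      le_rfl subset_rfl
    have h2 := (ih (z ^ 2) hz' fun j => a (2 * j + 1)).mono (F' := reImParts a (2 ^ (r + 1)))
      (reImParts_subset fun j hj => ⟨re_mem_reImParts a (by omega), im_mem_reImParts a (by omega)⟩)
      le_rfl subset_rfl
    -- The half-length transforms are periodic in `k`, so each of their values serves two outputs.
    have hmod : ∀ i k : ℕ, (z ^ 2) ^ (i * k) = (z ^ 2) ^ (i * (k % 2 ^ r)) := by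
      intro i k
      conv_lhs => rw [← Nat.mod_add_div k (2 ^ r), mul_add, pow_add,
        show i * (2 ^ r * (k / 2 ^ r)) = 2 ^ r * (i * (k / 2 ^ r)) by ring, pow_mul _ (2 ^ r),
        hz', one_pow, mul_one]
    have hsplit : ∀ k x, ∑ j ∈ Finset.range (2 ^ (r + 1)), a j x * z ^ (j * k) =
        e (k % 2 ^ r) x + z ^ k * o (k % 2 ^ r) x := by
      intro k x
      rw [hpow, sum_range_two_mul, he, ho, Finset.mul_sum]
      congr 1
      · refine Finset.sum_congr rfl fun j _ => ?_
        rw [← hmod, ← pow_mul]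
        ring_nf
      · refine Finset.sum_congr rfl fun j _ => ?_
        rw [← hmod, ← pow_mul]
        ring
    have h3 : ComputableFrom (reImParts e (2 ^ r) ∪ reImParts o (2 ^ r)) (2 ^ (r + 1) * (6 + 2))
        (reImParts (fun k x => ∑ j ∈ Finset.range (2 ^ (r + 1)), a j x * z ^ (j * k))
          (2 ^ (r + 1))) := by
      refine .reImParts_of_forall fun k _ => ?_
      simp only [hsplit]
      have hk : k % 2 ^ r < 2 ^ r := Nat.mod_lt _ (by positivity)
      have hm := ComputableFrom.complex_mul
        (F := reImParts e (2 ^ r) ∪ reImParts o (2 ^ r)) (a := o (k % 2 ^ r)) (z ^ k)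
        (.inr (re_mem_reImParts o hk)) (.inr (im_mem_reImParts o hk))
      refine (hm.trans_union (.complex_add (a := e (k % 2 ^ r))
        (b := fun x => z ^ k * o (k % 2 ^ r) x) (.inl (.inl (re_mem_reImParts e hk)))
        (.inl (.inl (im_mem_reImParts e hk))) (.inr ?_) (.inr ?_))).mono subset_rfl le_rfl
          Set.subset_union_right
      · exact Set.mem_insert _ _
      · exact Set.mem_insert_of_mem _ rfl
    refine ((h1.union h2).trans h3).mono subset_rfl ?_ subset_rfl
    rw [hpow]
    ring_nf
    rfl

/-- Fourier expansion of a Toeplitz kernel that is embedded into a circulant one. -/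
theorem exists_fourier_expansion (L p q : ℕ) (hL : p + q ≤ L) (c : ℤ → ℂ) :
    ∃ (z : ℂ) (d : ℕ → ℂ), z ^ L = 1 ∧ z ≠ 0 ∧ ∀ j < p, ∀ k < q,
      c ((j : ℤ) - k) = ∑ u ∈ Finset.range L, d u * z ^ (u * j) * z⁻¹ ^ (k * u) := by
  rcases Nat.eq_zero_or_pos L with rfl | hpos
  · exact ⟨1, 0, by simp, one_ne_zero, fun j hj => by omega⟩
  have : NeZero L := ⟨hpos.ne'⟩
  set z : ℂ := ZMod.stdAddChar (1 : ZMod L) with hz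
  have hzL : z ^ L = 1 := by
    rw [hz, ← AddChar.map_nsmul_eq_pow]
    simp
  have hz0 : z ≠ 0 := fun h => by
    rw [h, zero_pow hpos.ne'] at hzL
    exact zero_ne_one hzL
  -- Differences `j - k ≥ 0` have residues below `p`, negative ones have residues above `L - q ≥ p`,
  -- so the wrapped kernel is consistent. The coefficients `d` are then its normalized discrete
  -- Fourier transform.
  let Φ : ZMod L → ℂ := fun v => if v.val < p then c v.val else c (v.val - L)
  have hΦ : ∀ j < p, ∀ k < q, Φ ((j : ZMod L) - k) = c ((j : ℤ) - k) := by
    intro j hj k hk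
    rcases le_or_gt k j with h | h
    · have hv : ((j : ZMod L) - k).val = j - k := by
        rw [← Nat.cast_sub h, ZMod.val_natCast, Nat.mod_eq_of_lt (by omega)]
      simp only [Φ, hv, if_pos (show j - k < p by omega), Nat.cast_sub h]
    · have hv : ((j : ZMod L) - k).val = j + L - k := by
        have : (j : ZMod L) - k = ((j + L - k : ℕ) : ZMod L) := by
          rw [Nat.cast_sub (by omega)]; simp
        rw [this, ZMod.val_natCast, Nat.mod_eq_of_lt (by omega)]
      simp only [Φ, hv, if_neg (show ¬ j + L - k < p by omega)]
      congr 1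
      omega
  refine ⟨z, fun u => (L : ℂ)⁻¹ * ZMod.dft Φ u, hzL, hz0, fun j hj k hk => ?_⟩
  rw [← hΦ j hj k hk, ← LinearEquiv.symm_apply_apply ZMod.dft Φ, ZMod.invDFT_apply,
    LinearEquiv.symm_apply_apply, smul_eq_mul, Finset.mul_sum]
  refine Finset.sum_nbij' (fun u => u.val) (fun u => (u : ZMod L)) ?_ ?_ ?_ ?_ ?_
  · intro u _; exact Finset.mem_range.2 (ZMod.val_lt u)
  · intro u _; exact Finset.mem_univ _
  · intro u _; exact ZMod.natCast_zmod_val u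
  · intro u hu; exact ZMod.val_cast_of_lt (Finset.mem_range.1 hu)
  · intro u _
    have hchar : ∀ i : ℕ, ZMod.stdAddChar (u * (i : ZMod L)) = z ^ (u.val * i) := by
      intro i
      rw [hz, ← AddChar.map_nsmul_eq_pow]
      simp
    dsimp only
    rw [mul_sub, AddChar.map_sub_eq_div, hchar, hchar, ZMod.natCast_zmod_val, smul_eq_mul,
      mul_comm k, inv_pow]
    ring

/-- Fast multiplication by a Toeplitz matrix. -/
theorem ComputableFrom.toeplitz (r p q : ℕ) (hL : p + q ≤ 2 ^ r) (c : ℤ → ℂ)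
    (a : ℕ → (ι → ℝ) → ℂ) (ha : ∀ k, q ≤ k → a k = 0) :
    ComputableFrom (reImParts a (2 ^ r)) (16 * r * 2 ^ r + 6 * 2 ^ r)
      (reImParts (fun j x => ∑ k ∈ Finset.range q, c ((j : ℤ) - k) * a k x) p) := by
  obtain ⟨z, d, hz, hz0, hc⟩ := exists_fourier_expansion (2 ^ r) p q hL c
  have h1 := ComputableFrom.fourier r z⁻¹ (by rw [inv_pow, hz, inv_one]) a
  have h2 := h1.trans (.complex_mul_family _ d _)
  have h3 := h2.trans (.fourier r z hz _)
  refine h3.mono subset_rfl (by ring_nf; rfl) (reImParts_subset fun j hj => ?_)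
  have key : ∀ x, ∑ k ∈ Finset.range q, c ((j : ℤ) - k) * a k x =
      ∑ u ∈ Finset.range (2 ^ r),
        d u * (∑ k ∈ Finset.range (2 ^ r), a k x * z⁻¹ ^ (k * u)) * z ^ (u * j) := by
    intro x
    -- Zero padding: the transform has full length `2 ^ r`, but only the first `q` entries
    -- contribute.
    have hsub : Finset.range q ⊆ Finset.range (2 ^ r) := Finset.range_subset_range.2 (by omega)
    have : ∀ u, ∑ k ∈ Finset.range (2 ^ r), a k x * z⁻¹ ^ (k * u) =
        ∑ k ∈ Finset.range q, a k x * z⁻¹ ^ (k * u) := fun u =>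
      (Finset.sum_subset hsub fun k _ hk => by
        rw [ha k (by simpa using hk)]; simp).symm
    simp only [this, Finset.mul_sum, Finset.sum_mul]
    rw [Finset.sum_comm]
    refine Finset.sum_congr rfl fun k hk => ?_
    rw [hc j hj k (Finset.mem_range.1 hk), Finset.sum_mul]
    exact Finset.sum_congr rfl fun u _ => by ring
  simp only [key]
  exact ⟨re_mem_reImParts (fun k x => ∑ u ∈ Finset.range (2 ^ r),
      d u * (∑ k ∈ Finset.range (2 ^ r), a k x * z⁻¹ ^ (k * u)) * z ^ (u * k)) (by omega),
    im_mem_reImParts (fun k x => ∑ u ∈ Finset.range (2 ^ r),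
      d u * (∑ k ∈ Finset.range (2 ^ r), a k x * z⁻¹ ^ (k * u)) * z ^ (u * k)) (by omega)⟩

end Complex

/-! ### Operation counts of matrix-vector products -/

section MulCost

/-- Multiplication of a vector by `A` takes at most `k` operations. -/
def MulCost {ι κ : Type*} [Fintype κ] (A : Matrix ι κ ℝ) (k : ℕ) : Prop :=
  ∃ k' ≤ k, ∃ F : Set ((κ → ℝ) → ℝ), Computes k' F ∧ ∀ i, (fun x => A.mulVec x i) ∈ F

variable {ι κ : Type*} [Fintype κ] {A : Matrix ι κ ℝ} {k : ℕ}

theorem mem_range_apply {κ : Type*} (j : κ) :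
    (fun x : κ → ℝ => x j) ∈ Set.range fun (j : κ) (x : κ → ℝ) => x j :=
  ⟨j, rfl⟩

theorem MulCost.mulVecCostLE (h : MulCost A k) {B : ℝ} (hB : (k : ℝ) ≤ B) : MulVecCostLE A B := by
  obtain ⟨k', hk, F, hF, hA⟩ := h
  exact ⟨k', F, hF, (Nat.cast_le.2 hk).trans hB, hA⟩

theorem MulCost.mono (h : MulCost A k) {l : ℕ} (hkl : k ≤ l) : MulCost A l := by
  obtain ⟨k', hk, F, hF, hA⟩ := h
  exact ⟨k', hk.trans hkl, F, hF, hA⟩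

theorem MulCost.of_computableFrom
    (h : ComputableFrom (Set.range fun (j : κ) (x : κ → ℝ) => x j) k
      (Set.range fun i x => A.mulVec x i)) : MulCost A k := by
  obtain ⟨k', hk, S, hS, -, hA⟩ := h 0 _ .input subset_rfl
  exact ⟨k', hk, S, by rwa [zero_add] at hS, fun i => hA ⟨i, rfl⟩⟩

theorem MulCost.comp (h : MulCost A k) {τ : Type*} (g : κ → (τ → ℝ) → ℝ) :
    ComputableFrom (Set.range g) k (Set.range fun i x => A.mulVec (fun j => g j x) i) := by
  obtain ⟨k', hk, F, hF, hA⟩ := h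
  refine (hF.comp g).mono subset_rfl hk ?_
  rintro _ ⟨i, rfl⟩
  exact ⟨_, hA i, rfl⟩

theorem MulCost.one_kronecker {K : Type*} [Fintype K] [DecidableEq K] (h : MulCost A k) :
    MulCost ((1 : Matrix K K ℝ) ⊗ₖ A) (Fintype.card K * k) := by
  refine .of_computableFrom ?_
  have h1 := ComputableFrom.biUnion Finset.univ fun (a : K) _ =>
    (h.comp fun j (x : K × κ → ℝ) => x (a, j)).mono
      (F' := Set.range fun (j : K × κ) (x : K × κ → ℝ) => x j)
      (by rintro _ ⟨j, rfl⟩; exact ⟨(a, j), rfl⟩) le_rfl subset_rfl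
  refine h1.mono subset_rfl (by simp) ?_
  rintro _ ⟨⟨a, i⟩, rfl⟩
  simp only [one_kronecker_mulVec]
  exact Set.mem_biUnion (Finset.mem_coe.2 (Finset.mem_univ a)) ⟨i, rfl⟩

theorem MulCost.blockDiagonal' {o : Type*} [Fintype o] [DecidableEq o] {ι κ : o → Type*}
    [∀ b, Fintype (κ b)] {A : ∀ b, Matrix (ι b) (κ b) ℝ} {c : o → ℕ}
    (h : ∀ b, MulCost (A b) (c b)) : MulCost (Matrix.blockDiagonal' A) (∑ b, c b) := by
  refine .of_computableFrom ?_
  have h1 := ComputableFrom.biUnion Finset.univ fun (b : o) _ =>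
    ((h b).comp fun j (x : ((b : o) × κ b) → ℝ) => x ⟨b, j⟩).mono
      (F' := Set.range fun (j : (b : o) × κ b) (x : ((b : o) × κ b) → ℝ) => x j)
      (by rintro _ ⟨j, rfl⟩; exact ⟨⟨b, j⟩, rfl⟩) le_rfl subset_rfl
  refine h1.mono subset_rfl le_rfl ?_
  rintro _ ⟨⟨b, i⟩, rfl⟩
  simp only [blockDiagonal'_mulVec]
  exact Set.mem_biUnion (Finset.mem_coe.2 (Finset.mem_univ b)) ⟨i, rfl⟩

theorem MulCost.diag3 {a₁ a₂ b₁ b₂ c₁ c₂ : Type*} [Fintype a₂] [Fintype b₂] [Fintype c₂]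
    {A : Matrix a₁ a₂ ℝ} {B : Matrix b₁ b₂ ℝ} {C : Matrix c₁ c₂ ℝ} {kA kB kC : ℕ}
    (hA : MulCost A kA) (hB : MulCost B kB) (hC : MulCost C kC) :
    MulCost (diag3 A B C) (kA + kB + kC) := by
  refine .of_computableFrom ?_
  have h1 := (hA.comp fun j (x : a₂ ⊕ b₂ ⊕ c₂ → ℝ) => x (Sum.inl j)).mono
    (F' := Set.range fun (j : a₂ ⊕ b₂ ⊕ c₂) (x : a₂ ⊕ b₂ ⊕ c₂ → ℝ) => x j)
    (by rintro _ ⟨j, rfl⟩; exact ⟨_, rfl⟩) le_rfl subset_rfl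
  have h2 := (hB.comp fun j (x : a₂ ⊕ b₂ ⊕ c₂ → ℝ) => x (Sum.inr (Sum.inl j))).mono
    (F' := Set.range fun (j : a₂ ⊕ b₂ ⊕ c₂) (x : a₂ ⊕ b₂ ⊕ c₂ → ℝ) => x j)
    (by rintro _ ⟨j, rfl⟩; exact ⟨_, rfl⟩) le_rfl subset_rfl
  have h3 := (hC.comp fun j (x : a₂ ⊕ b₂ ⊕ c₂ → ℝ) => x (Sum.inr (Sum.inr j))).mono
    (F' := Set.range fun (j : a₂ ⊕ b₂ ⊕ c₂) (x : a₂ ⊕ b₂ ⊕ c₂ → ℝ) => x j)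
    (by rintro _ ⟨j, rfl⟩; exact ⟨_, rfl⟩) le_rfl subset_rfl
  refine ((h1.union h2).union h3).mono subset_rfl le_rfl ?_
  rintro _ ⟨i | i | i, rfl⟩
  · simp only [diag3_mulVec_inl]; exact .inl (.inl ⟨i, rfl⟩)
  · simp only [diag3_mulVec_inr_inl]; exact .inl (.inr ⟨i, rfl⟩)
  · simp only [diag3_mulVec_inr_inr]; exact .inr ⟨i, rfl⟩

theorem MulCost.diagonal [DecidableEq κ] (d : κ → ℝ) :
    MulCost (Matrix.diagonal d) (Fintype.card κ) := by
  refine .of_computableFrom ?_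
  simp only [Matrix.mulVec_diagonal]
  exact (ComputableFrom.range_of_forall fun i => .smul (d i) (mem_range_apply i)).mono subset_rfl
    (by simp) subset_rfl

theorem MulCost.one [DecidableEq κ] : MulCost (1 : Matrix κ κ ℝ) 0 := by
  refine .of_computableFrom (.of_subset ?_)
  simp only [Matrix.one_mulVec, subset_rfl]

theorem MulCost.submatrix_rows (h : MulCost A k) {τ : Type*} (e : τ → ι) :
    MulCost (A.submatrix e id) k := by
  obtain ⟨k', hk, F, hF, hA⟩ := h
  exact ⟨k', hk, F, hF, fun i => hA (e i)⟩

theorem MulCost.submatrix_columns (h : MulCost A k) {τ : Type*} [Fintype τ] (e : τ ≃ κ) :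
    MulCost (A.submatrix id e) k := by
  refine .of_computableFrom ?_
  have h1 := h.comp fun j (x : τ → ℝ) => x (e.symm j)
  refine h1.mono ?_ le_rfl ?_
  · rintro _ ⟨j, rfl⟩; exact ⟨_, rfl⟩
  · rintro _ ⟨i, rfl⟩
    refine ⟨i, ?_⟩
    funext x
    simp only [Matrix.mulVec, dotProduct, Matrix.submatrix_apply, id]
    exact (Equiv.sum_comp e fun j => A i j * x (e.symm j)).symm.trans (by simp)

theorem MulCost.smul_H (c : ℝ) (s : ℕ) : MulCost (c • H s) (2 * s) := by
  refine .of_computableFrom ?_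
  simp only [Matrix.smul_mulVec, Pi.smul_apply, H_mulVec, smul_eq_mul]
  exact (ComputableFrom.range_of_forall fun i : Fin (2 * s) => .smul c (mem_range_apply ⟨(i : ℕ) / 2, by omega⟩)).mono
    subset_rfl (by simp) subset_rfl

theorem H_transpose_mulVec (s : ℕ) (x : Fin (2 * s) → ℝ) (j : Fin s) :
    (H s).transpose.mulVec x j = x ⟨2 * j, by omega⟩ + x ⟨2 * j + 1, by omega⟩ := by
  simp only [Matrix.mulVec, dotProduct, Matrix.transpose_apply, H, Matrix.of_apply, ite_mul,
    one_mul, zero_mul]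
  rw [Fintype.sum_eq_add (⟨2 * j, by omega⟩ : Fin (2 * s)) ⟨2 * j + 1, by omega⟩]
  · rw [if_pos (by dsimp only; omega), if_pos (by dsimp only; omega)]
  · simp
  · rintro i ⟨h1, h2⟩
    rw [if_neg]
    intro h
    simp only [Ne, Fin.ext_iff] at h1 h2
    omega

theorem MulCost.smul_H_transpose (c : ℝ) (s : ℕ) : MulCost (c • H s).transpose (2 * s) := by
  refine .of_computableFrom ?_
  simp only [Matrix.transpose_smul, Matrix.smul_mulVec, Pi.smul_apply, H_transpose_mulVec,
    smul_eq_mul]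
  refine (ComputableFrom.range_of_forall (k := 2) fun i => ?_).mono subset_rfl
    (by simp [mul_comm]) subset_rfl
  exact (ComputableFrom.add (f := fun x : Fin (2 * s) → ℝ => x ⟨2 * i, by omega⟩)
    (g := fun x => x ⟨2 * i + 1, by omega⟩) (mem_range_apply _)
    (mem_range_apply _)).trans (.smul c rfl)

/-- Bluestein's algorithm: multiplication by a sine matrix with arbitrary frequency and shifts. -/
theorem MulCost.sine (r p q : ℕ) (hq : 0 < q) (hL : p + q ≤ 2 ^ r) (c α a b : ℝ) :
    MulCost (Matrix.of fun (j : Fin p) (k : Fin q) =>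
      c * Real.sin (α * ((k : ℝ) + a) * ((j : ℝ) + b))) ((16 * r + 15) * 2 ^ r) := by
  refine .of_computableFrom ?_
  set F : Set ((Fin q → ℝ) → ℝ) := Set.range fun j x => x j
  -- With `K = k + a` and `J = j + b`, `2 J K = J ^ 2 + K ^ 2 - (J - K) ^ 2`. Hence `w j * t (j - k)
  -- * v k = exp (i α K J)`, whose middle factor is a Toeplitz kernel and whose imaginary part is
  -- the required sine.
  let v : ℕ → ℂ := fun k => Complex.exp ((α / 2 * ((k : ℝ) + a) ^ 2 : ℝ) * Complex.I)
  let w : ℕ → ℂ := fun j => Complex.exp ((α / 2 * ((j : ℝ) + b) ^ 2 : ℝ) * Complex.I)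
  let t : ℤ → ℂ := fun d => Complex.exp ((-(α / 2 * ((d : ℝ) + b - a) ^ 2) : ℝ) * Complex.I)
  let y : ℕ → (Fin q → ℝ) → ℂ := fun k x => if h : k < q then v k * x ⟨k, h⟩ else 0
  have h1 : ComputableFrom F (2 ^ r * 2) (reImParts y (2 ^ r)) := by
    refine .reImParts_of_forall fun k _ => ?_
    have hsmul : ∀ (d : ℝ) (i : Fin q), ComputableFrom F 1 {fun x => d * x i} :=
      fun d i => .smul d ⟨i, rfl⟩
    by_cases h : k < q
    · refine ((hsmul (v k).re ⟨k, h⟩).union (hsmul (v k).im ⟨k, h⟩)).mono subset_rfl le_rfl ?_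
      simp only [y, dif_pos h, Complex.re_mul_ofReal, Complex.im_mul_ofReal]
      rw [Set.insert_eq]
    -- The zero function is not available for free; it is computed as `0 * x 0`, which needs an
    -- input entry.
    · refine ((hsmul 0 ⟨0, hq⟩).union (hsmul 0 ⟨0, hq⟩)).mono subset_rfl le_rfl ?_
      simp [y, dif_neg h]
  have h2 := h1.trans (.toeplitz r p q hL t y fun k hk => funext fun x => dif_neg (by omega))
  have h3 := h2.trans (.complex_mul_family _ w p)
  have h4 : ∀ (j : ℕ) (x : Fin q → ℝ),
      (w j * ∑ k ∈ Finset.range q, t ((j : ℤ) - k) * y k x).im =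
        ∑ k : Fin q, Real.sin (α * ((k : ℝ) + a) * ((j : ℝ) + b)) * x k := by
    intro j x
    rw [Finset.sum_range, Finset.mul_sum, Complex.im_sum]
    refine Finset.sum_congr rfl fun k _ => ?_
    have e : w j * (t ((j : ℤ) - (k : ℕ)) * y k x) =
        Complex.exp ((α * ((k : ℝ) + a) * ((j : ℝ) + b) : ℝ) * Complex.I) * x k := by
      simp only [y, dif_pos k.2, w, t, v]
      rw [← mul_assoc, ← mul_assoc, ← Complex.exp_add, ← Complex.exp_add]
      congr 2
      push_cast
      ring
    rw [e, Complex.im_mul_ofReal, Complex.exp_ofReal_mul_I_im]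
  have h5 := h3.trans (.range_of_forall (g := fun (j : Fin p) (x : Fin q → ℝ) =>
      c * (w j * ∑ k ∈ Finset.range q, t (((j : ℕ) : ℤ) - k) * y k x).im) fun j =>
    .smul c (im_mem_reImParts (fun j x => w j * ∑ k ∈ Finset.range q, t ((j : ℤ) - k) * y k x) j.2))
  refine h5.mono subset_rfl ?_ ?_
  -- Besides the Toeplitz product there are `2 * 2 ^ r` operations before it and `7 p` after it,
  -- with `p ≤ 2 ^ r`; this gives `15 = 2 + 6 + 7`.
  · rw [Fintype.card_fin]
    nlinarith
  · rintro _ ⟨j, rfl⟩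
    refine ⟨j, funext fun x => ?_⟩
    simp only [h4]
    simp only [Matrix.mulVec, dotProduct, Matrix.of_apply, Finset.mul_sum, mul_assoc]

end MulCost

/-! ### Operation counts of the factors -/

/-- An instance of `MulCost.sine` with `α = π / (t + 1)`, frequency shift `1` and sample shift `1 /
2`; transposing exchanges the two shifts. -/
theorem MulCost.dstU {r t : ℕ} (ht : 0 < t) (hr : t + 1 + t ≤ 2 ^ r) :
    MulCost (dstU t) ((16 * r + 15) * 2 ^ r) := by
  convert MulCost.sine r (t + 1) t ht hr (√(2 / ((t : ℝ) + 1))) (Real.pi / ((t : ℝ) + 1)) 1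
    (1 / 2) using 1
  ext j k
  simp only [ADRT.dstU, Matrix.of_apply]
  ring_nf

theorem MulCost.dstU_transpose {r t : ℕ} (hr : t + 1 + t ≤ 2 ^ r) :
    MulCost (ADRT.dstU t).transpose ((16 * r + 15) * 2 ^ r) := by
  convert MulCost.sine r t (t + 1) (by omega) (by omega) (√(2 / ((t : ℝ) + 1)))
    (Real.pi / ((t : ℝ) + 1)) (1 / 2) 1 using 1
  ext j k
  simp only [ADRT.dstU, Matrix.of_apply, Matrix.transpose_apply]
  ring_nf

theorem MulCost.dstV {r t : ℕ} (ht : 0 < t) (hr : t + t ≤ 2 ^ r) :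
    MulCost (dstV t) ((16 * r + 15) * 2 ^ r) := by
  convert MulCost.sine r t t ht hr (√(2 / ((t : ℝ) + 1))) (Real.pi / ((t : ℝ) + 1)) 1 1 using 1
  ext j k
  simp only [ADRT.dstV, Matrix.of_apply]
  ring_nf

theorem dstV_transpose (t : ℕ) : (dstV t).transpose = dstV t := by
  ext j k
  simp only [dstV, Matrix.of_apply, Matrix.transpose_apply]
  ring_nf

/-- A bound for the number of operations that a factor takes on one block. -/
def blockCost (n : ℕ) : ℕ := (16 * (n + 3) + 15) * 2 ^ (n + 3) + 2 * 2 ^ n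

section Blocks

variable {n s : ℕ}

theorem MulCost.blockU (hs : 2 * s ≤ 2 ^ n) : MulCost (blockU (2 ^ n) s) (blockCost n) := by
  have hN : 0 < 2 ^ n := by positivity
  -- With `t = 2 N` the circulant length must be at least `4 N + 1`, and the power of two `8 N`
  -- suffices. The two outer blocks take `4 s ≤ 2 N` operations.
  have hr : 2 ^ (n + 3) = 8 * 2 ^ n := by ring
  refine (MulCost.diag3 (.smul_H _ s) (.dstU (r := n + 3) (by omega) (by omega))
    (.smul_H _ s)).mono ?_
  unfold blockCost
  omega

theorem MulCost.blockU_transpose (hs : 2 * s ≤ 2 ^ n) :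
    MulCost (ADRT.blockU (2 ^ n) s).transpose (blockCost n) := by
  have hN : 0 < 2 ^ n := by positivity
  have hr : 2 ^ (n + 3) = 8 * 2 ^ n := by ring
  rw [ADRT.blockU, diag3_transpose]
  refine (MulCost.diag3 (.smul_H_transpose _ s) (.dstU_transpose (r := n + 3) (by omega))
    (.smul_H_transpose _ s)).mono ?_
  unfold blockCost
  omega

theorem MulCost.blockV : MulCost (blockV (2 ^ n) s) (blockCost n) := by
  have hN : 0 < 2 ^ n := by positivity
  have hr : 2 ^ (n + 3) = 8 * 2 ^ n := by ring
  refine (MulCost.diag3 .one (.dstV (r := n + 3) (by omega) (by omega)) .one).mono ?_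
  unfold blockCost
  omega

theorem blockV_transpose (N s : ℕ) : (ADRT.blockV N s).transpose = ADRT.blockV N s := by
  rw [ADRT.blockV, diag3_transpose, dstV_transpose, Matrix.transpose_one]

theorem MulCost.blockSigma (hs : 2 * s ≤ 2 ^ n) : MulCost (blockSigma (2 ^ n) s) (blockCost n) := by
  have hr : 2 ^ (n + 3) = 8 * 2 ^ n := by ring
  rw [blockSigma_eq_diagonal]
  refine (MulCost.diagonal _).mono ?_
  simp only [Fintype.card_sum, Fintype.card_fin, blockCost]
  rw [hr]
  nlinarith [Nat.zero_le (n * 2 ^ n)]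

end Blocks

/-- A bound for the number of operations that a factor takes altogether. -/
def levelCost (n m : ℕ) : ℕ := 4 * (2 ^ (n - m) * (2 ^ (m - 1) * blockCost n))

theorem MulCost.one_kronecker_blockDiagonal' {n m : ℕ} {ι κ : Fin (2 ^ (m - 1)) → Type*}
    [∀ s, Fintype (κ s)] {A : ∀ s, Matrix (ι s) (κ s) ℝ} (h : ∀ s, MulCost (A s) (blockCost n)) :
    MulCost ((1 : Matrix (Fin (2 ^ (n - m))) (Fin (2 ^ (n - m))) ℝ) ⊗ₖ Matrix.blockDiagonal' A)
      (2 ^ (n - m) * (2 ^ (m - 1) * blockCost n)) := by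
  refine (MulCost.blockDiagonal' h).one_kronecker.mono ?_
  simp

theorem MulCost.one_kronecker_four {n m : ℕ} {ι κ : Type*} [Fintype κ] {A : Matrix ι κ ℝ}
    (h : MulCost A (2 ^ (n - m) * (2 ^ (m - 1) * blockCost n))) :
    MulCost ((1 : Matrix (Fin 4) (Fin 4) ℝ) ⊗ₖ A) (levelCost n m) :=
  h.one_kronecker.mono (by simp [levelCost])

theorem levelCost_le {n m : ℕ} (hm : 1 ≤ m) (hmn : m ≤ n) (hn : 2 ≤ n) :
    (levelCost n m : ℝ) ≤ 1568 * ((2 : ℝ) ^ n) ^ 2 * Real.log ((2 : ℝ) ^ n) := by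
  have h1 : levelCost n m = 2 * 2 ^ n * blockCost n := by
    have : 2 * 2 ^ n = 4 * (2 ^ (n - m) * 2 ^ (m - 1)) := by
      rw [← pow_add, show n = n - m + (m - 1) + 1 by omega]
      simp only [pow_succ]
      rw [show n - m + (m - 1) + 1 - m + (m - 1) = n - m + (m - 1) by omega]
      ring
    rw [this, levelCost]
    ring
  -- The exact factor of `2 ^ n` is `128 n + 506`, and `506 ≤ 253 n` for `n ≥ 2`; `392` leaves some
  -- slack.
  have h2 : blockCost n ≤ 392 * n * 2 ^ n := by
    have hr : 2 ^ (n + 3) = 8 * 2 ^ n := by ring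
    have hn' : 2 * 2 ^ n ≤ n * 2 ^ n := Nat.mul_le_mul_right _ hn
    rw [blockCost, hr]
    generalize 2 ^ n = N at *
    nlinarith
  have h3 : (levelCost n m : ℝ) ≤ 784 * n * ((2 : ℝ) ^ n) ^ 2 := by
    have : levelCost n m ≤ 784 * n * (2 ^ n) ^ 2 := by
      rw [h1]
      calc 2 * 2 ^ n * blockCost n ≤ 2 * 2 ^ n * (392 * n * 2 ^ n) := Nat.mul_le_mul_left _ h2
        _ = _ := by ring
    exact_mod_cast this
  -- This uses `log 2 > 1 / 2`; the constant becomes `1568 = 2 * 2 * 392`.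
  have h4 : (n : ℝ) ≤ 2 * Real.log ((2 : ℝ) ^ n) := by
    rw [Real.log_pow]
    nlinarith [Real.log_two_gt_d9, (Nat.cast_nonneg n : (0 : ℝ) ≤ n)]
  calc (levelCost n m : ℝ) ≤ 784 * n * ((2 : ℝ) ^ n) ^ 2 := h3
    _ ≤ 784 * (2 * Real.log ((2 : ℝ) ^ n)) * ((2 : ℝ) ^ n) ^ 2 := by gcongr
    _ = _ := by ring

section Levels

variable {n m : ℕ}

theorem two_mul_block_le (hm : 1 ≤ m) (hmn : m ≤ n) (s : Fin (2 ^ (m - 1))) :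
    2 * (s : ℕ) ≤ 2 ^ n :=
  calc 2 * (s : ℕ) ≤ 2 * 2 ^ (m - 1) := Nat.mul_le_mul_left _ s.2.le
    _ = 2 ^ m := by rw [← pow_succ']; congr 1; omega
    _ ≤ 2 ^ n := Nat.pow_le_pow_right two_pos hmn

theorem MulCost.fullU (hm : 1 ≤ m) (hmn : m ≤ n) : MulCost (fullU n m) (levelCost n m) := by
  rw [ADRT.fullU, permQ_mul hm hmn]
  exact .one_kronecker_four (.submatrix_rows
    (.one_kronecker_blockDiagonal' fun s => .blockU (two_mul_block_le hm hmn s)) _)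

theorem MulCost.fullU_transpose (hm : 1 ≤ m) (hmn : m ≤ n) :
    MulCost (ADRT.fullU n m).transpose (levelCost n m) := by
  rw [ADRT.fullU, permQ_mul hm hmn, one_kronecker_transpose, Matrix.transpose_submatrix, levelU,
    one_kronecker_transpose, Matrix.blockDiagonal'_transpose]
  exact .one_kronecker_four (.submatrix_columns
    (.one_kronecker_blockDiagonal' fun s => .blockU_transpose (two_mul_block_le hm hmn s)) _)

theorem MulCost.fullSigma (hm : 1 ≤ m) (hmn : m ≤ n) : MulCost (fullSigma n m) (levelCost n m) :=
  .one_kronecker_four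
    (.one_kronecker_blockDiagonal' fun s => .blockSigma (two_mul_block_le hm hmn s))

theorem MulCost.fullV (hm : 1 ≤ m) (hmn : m ≤ n) : MulCost (fullV n m) (levelCost n m) := by
  rw [ADRT.fullV, permP_transpose_mul hm hmn]
  exact .one_kronecker_four (.submatrix_rows (.one_kronecker_blockDiagonal' fun _ => .blockV) _)

theorem MulCost.fullV_transpose (hm : 1 ≤ m) (hmn : m ≤ n) :
    MulCost (ADRT.fullV n m).transpose (levelCost n m) := by
  rw [ADRT.fullV, permP_transpose_mul hm hmn, one_kronecker_transpose, Matrix.transpose_submatrix,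
    levelV, one_kronecker_transpose, Matrix.blockDiagonal'_transpose]
  simp only [blockV_transpose]
  exact .one_kronecker_four (.submatrix_columns (.one_kronecker_blockDiagonal' fun _ => .blockV) _)

end Levels

end ADRT

theorem theorem3p4 :
    (∀ n m : ℕ, 2 ≤ m → m ≤ n →
      ADRT.IsSVD (ADRT.fullLevel n m) (ADRT.fullU n m) (ADRT.fullSigma n m) (ADRT.fullV n m)) ∧
    ∃ C : ℝ, ∀ n m : ℕ, 2 ≤ m → m ≤ n →
      ADRT.MulVecCostLE (ADRT.fullU n m) (C * ((2 : ℝ) ^ n) ^ 2 * Real.log ((2 : ℝ) ^ n)) ∧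
      ADRT.MulVecCostLE (ADRT.fullU n m).transpose
        (C * ((2 : ℝ) ^ n) ^ 2 * Real.log ((2 : ℝ) ^ n)) ∧
      ADRT.MulVecCostLE (ADRT.fullSigma n m) (C * ((2 : ℝ) ^ n) ^ 2 * Real.log ((2 : ℝ) ^ n)) ∧
      ADRT.MulVecCostLE (ADRT.fullV n m) (C * ((2 : ℝ) ^ n) ^ 2 * Real.log ((2 : ℝ) ^ n)) ∧
      ADRT.MulVecCostLE (ADRT.fullV n m).transpose
        (C * ((2 : ℝ) ^ n) ^ 2 * Real.log ((2 : ℝ) ^ n)) := by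
  refine ⟨fun n m hm hmn => ADRT.isSVD_fullLevel (by omega) hmn, 1568, fun n m hm hmn => ?_⟩
  have hm1 : 1 ≤ m := by omega
  have hC := ADRT.levelCost_le hm1 hmn (hm.trans hmn)
  exact ⟨(ADRT.MulCost.fullU hm1 hmn).mulVecCostLE hC,
    (ADRT.MulCost.fullU_transpose hm1 hmn).mulVecCostLE hC,
    (ADRT.MulCost.fullSigma hm1 hmn).mulVecCostLE hC,
    (ADRT.MulCost.fullV hm1 hmn).mulVecCostLE hC,
    (ADRT.MulCost.fullV_transpose hm1 hmn).mulVecCostLE hC⟩
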